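/- **Setting.** Let $\Lambda\subset\mathbb R^d$ be compact. A curve in $\Lambda$ is given by a continuous function $f:[0,1]\to\Lambda$; the distance of the curves given by $f_1,f_2$ is $\inf_{\phi_1,\phi_2}\sup_t|f_1(\phi_1(t))-f_2(\phi_2(t))|$, the infimum being over strictly monotone continuous maps of $[0,1]$ onto itself, and functions at distance $0$ are identified (they are parametrizations of the same curve). Let $\Omega_\Lambda$ be the space of closed sets $\mathcal F$ of curves in $\Lambda$, with the Hausdorff metric and its Borel $\sigma$-algebra. A system of random curves in $\Lambda$ with short-distance cutoff is a family of Borel probability measures $(\mu_\delta)_{0<\delta\le\delta_{\max}}$ on $\Omega_\Lambda$, $0<\delta_{\max}\le 1$, for which there is $N<\infty$ such that for all $\delta$ and $\mu_\delta$-almost every $\mathcal F$, every $\mathcal C\in\mathcal F$ is a polygonal path with steps of length at most $\delta$, of which at most $N$ vertices (counted with multiplicity along the path) lie in any closed ball of radius $\delta$. Random variables $X_\delta$ are stochastically bounded as $\delta\to0$ if for every $\eta>0$ there is $u<\infty$ with $\mu_\delta(|X_\delta|\ge u)\le\eta$ for all $\delta\in(0,\delta_{\max}]$. **Hypothesis H1.**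 There are constants $K_k<\infty$ and exponents $\lambda(k)$ with $\lambda(k)\to\infty$ as $k\to\infty$, such that for all $k\ge1$, all $\delta\in(0,\delta_{\max}]$, all $x\in\mathbb R^d$ and all $\delta\le r<R\le1$, the $\mu_\delta$-probability that the shell $D(x;r,R)=\{y: r\le|y-x|\le R\}$ is traversed by $k$ separate segments of some curve $\mathcal C\in\mathcal F$ is at most $K_k\,(r/R)^{\lambda(k)}$. **Theorem (Regularity).** Let $(\mu_\delta)$ be a system of random curves in a compact $\Lambda\subset\mathbb R^d$ satisfying H1, with $0\le\lambda(1)<d$. Then for every $\varepsilon>0$ with $d-\lambda(1)+\varepsilon\ge1$ (that is, for every $\varepsilon>0$ if $\lambda(1)\le d-1$) there are random variables $\kappa_{\varepsilon;\delta}$ on $\Omega_\Lambda$, stochastically bounded as $\delta\to0$, such that for every $\delta\in(0,\delta_{\max}]$ and $\mu_\delta$-almost every $\mathcal F$, every curve $\mathcal C\in\mathcal F$ has a parametrization $\gamma:[0,1]\to\Lambda$ with $$|\gamma(t_1)-\gamma(t_2)|\ \le\ \kappa_{\varepsilon;\delta}(\mathcal F)\; g(\operatorname{diam}\mathcal C)^{1+\varepsilon}\;|t_1-t_2|^{\frac1{d-\lambda(1)+\varepsilon}}\qquad\text{for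 all }0\le t_1<t_2\le1,$$ where $g(r)=r^{-\lambda(1)/(d-\lambda(1))}$. -/

import Mathlib

open Set Filter Topology MeasureTheory TopologicalSpace
open scoped unitInterval ENNReal

namespace RandomCurves

noncomputable section

/-! ### The space of curves -/

/-- A parametrized curve in `X`: a continuous function `[0,1] → X`. -/
structure ParamCurve (X : Type*) [TopologicalSpace X] where
  toMap : C(I, X)

/-- The reparametrization `γ ∘ φ` by a homeomorphism `φ` of `[0,1]`, that is, by a strictly
monotone (increasing or decreasing) continuous map of `[0,1]` onto itself. -/
def ParamCurve.reparam {X : Type*} [TopologicalSpace X] (γ : ParamCurve X) (φ : I ≃ₜ I) :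
    C(I, X) :=
  γ.toMap.comp (φ : C(I, I))

/-- The distance between two curves given by parametrizations `f₁`, `f₂`:
`inf_{φ₁, φ₂} sup_t |f₁ (φ₁ t) - f₂ (φ₂ t)|`, the infimum being over all strictly monotone
continuous maps `φ₁`, `φ₂` of `[0,1]` onto itself (`dist` on `C(I, X)` is the sup distance). -/
def curveDist {X : Type*} [PseudoMetricSpace X] (f₁ f₂ : ParamCurve X) : ℝ :=
  ⨅ φ : (I ≃ₜ I) × (I ≃ₜ I), dist (f₁.reparam φ.1) (f₂.reparam φ.2)

section DistFacts

variable {X : Type*} [PseudoMetricSpace X]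

theorem curveDist_bddBelow (f g : ParamCurve X) :
    BddBelow (range fun φ : (I ≃ₜ I) × (I ≃ₜ I) => dist (f.reparam φ.1) (g.reparam φ.2)) :=
  ⟨0, by rintro _ ⟨φ, rfl⟩; exact dist_nonneg⟩

theorem curveDist_le (f g : ParamCurve X) (φ ψ : I ≃ₜ I) :
    curveDist f g ≤ dist (f.reparam φ) (g.reparam ψ) :=
  ciInf_le (curveDist_bddBelow f g) (φ, ψ)

theorem curveDist_nonneg (f g : ParamCurve X) : 0 ≤ curveDist f g :=
  Real.iInf_nonneg fun _ => dist_nonneg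

theorem curveDist_self (f : ParamCurve X) : curveDist f f = 0 :=
  le_antisymm (by simpa using curveDist_le f f (Homeomorph.refl I) (Homeomorph.refl I))
    (curveDist_nonneg f f)

theorem curveDist_comm (f g : ParamCurve X) : curveDist f g = curveDist g f := by
  have key : ∀ f g : ParamCurve X, curveDist f g ≤ curveDist g f := fun f g =>
    le_ciInf fun φ => by rw [dist_comm]; exact curveDist_le f g φ.2 φ.1
  exact le_antisymm (key f g) (key g f)

theorem dist_reparam_trans (f g : ParamCurve X) (φ ψ χ : I ≃ₜ I) :
    dist (f.reparam (χ.trans φ)) (g.reparam (χ.trans ψ)) ≤ dist (f.reparam φ) (g.reparam ψ) :=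
  (ContinuousMap.dist_le dist_nonneg).2 fun t =>
    ContinuousMap.dist_apply_le_dist (f := f.reparam φ) (g := g.reparam ψ) (χ t)

theorem curveDist_triangle (f g h : ParamCurve X) :
    curveDist f h ≤ curveDist f g + curveDist g h := by
  refine le_of_forall_pos_le_add fun η hη => ?_
  obtain ⟨⟨φ₁, φ₂⟩, h₁⟩ := exists_lt_of_ciInf_lt
    (show curveDist f g < curveDist f g + η / 2 by linarith)
  obtain ⟨⟨ψ₁, ψ₂⟩, h₂⟩ := exists_lt_of_ciInf_lt
    (show curveDist g h < curveDist g h + η / 2 by linarith)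
  have e₁ := dist_reparam_trans f g φ₁ φ₂ φ₂.symm
  have e₂ := dist_reparam_trans g h ψ₁ ψ₂ ψ₁.symm
  rw [Homeomorph.symm_trans_self] at e₁ e₂
  have e₃ := dist_triangle (f.reparam (φ₂.symm.trans φ₁)) (g.reparam (Homeomorph.refl I))
    (h.reparam (ψ₁.symm.trans ψ₂))
  have e₄ := curveDist_le f h (φ₂.symm.trans φ₁) (ψ₁.symm.trans ψ₂)
  dsimp only at h₁ h₂
  linarith

end DistFacts

instance {X : Type*} [PseudoMetricSpace X] : PseudoMetricSpace (ParamCurve X) where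
  dist := curveDist
  dist_self := curveDist_self
  dist_comm := curveDist_comm
  dist_triangle := curveDist_triangle

/-- The metric space `S_X` of curves in `X`: continuous functions `[0,1] → X`, two of them being
the same curve if their distance `curveDist` vanishes. (Among functions which are not constant on
any interval this means that they agree after reparametrizing both by homeomorphisms of `[0,1]`.) -/
abbrev Curve (X : Type*) [PseudoMetricSpace X] := SeparationQuotient (ParamCurve X)

/-- `γ` is a parametrization of the curve `C`. -/
def Parametrizes {X : Type*} [PseudoMetricSpace X] (γ : ParamCurve X) (C : Curve X) : Prop :=
  SeparationQuotient.mk γ = C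

/-- The space `Ω_X` of configurations: closed sets of curves in `X`, with the (extended) Hausdorff
metric. -/
abbrev Config (X : Type*) [PseudoMetricSpace X] := Closeds (Curve X)

instance {X : Type*} [PseudoMetricSpace X] : MeasurableSpace (Config X) := borel _

instance {X : Type*} [PseudoMetricSpace X] : BorelSpace (Config X) := ⟨rfl⟩

/-! ### Polygonal paths and crossings of shells -/

/-- `C` is a polygonal path of step size `δ`, with local complexity at most `N`: it can be
parametrized by running linearly, in time `1 / n` for each step, through points `v 0, …, v n` of
`ℝ^d`, consecutive ones being at distance at most `δ`, such that any closed ball of radius `δ`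
contains at most `N` of these points (counted with multiplicity). -/
def IsPolygonal {d : ℕ} {Λ : Set (EuclideanSpace ℝ (Fin d))} (δ : ℝ) (N : ℕ) (C : Curve Λ) :
    Prop :=
  ∃ (γ : ParamCurve Λ) (n : ℕ) (v : ℕ → EuclideanSpace ℝ (Fin d)),
    Parametrizes γ C ∧ 1 ≤ n ∧
    (∀ i < n, dist (v i) (v (i + 1)) ≤ δ) ∧
    (∀ i < n, ∀ t : I, ∀ θ ∈ Icc (0 : ℝ) 1, (n : ℝ) * t = i + θ →
      (γ.toMap t : EuclideanSpace ℝ (Fin d)) = AffineMap.lineMap (v i) (v (i + 1)) θ) ∧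
    ∀ x : EuclideanSpace ℝ (Fin d),
      {i : ℕ | i ≤ n ∧ dist (v i) x ≤ δ}.ncard ≤ N

/-- The shell `D(x; r, R) = {y | r ≤ |y - x| ≤ R}` is traversed by `k` separate segments of the
curve `C`: there are `k` non-overlapping time intervals `[s i, t i]` such that over each of them
the curve gets from the inner ball `|y - x| ≤ r` to the outer region `|y - x| ≥ R`, or back. -/
def Traversed {d : ℕ} {Λ : Set (EuclideanSpace ℝ (Fin d))} (C : Curve Λ) (k : ℕ)
    (x : EuclideanSpace ℝ (Fin d)) (r R : ℝ) : Prop :=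
  ∃ γ : ParamCurve Λ, Parametrizes γ C ∧ ∃ s t : Fin k → I,
    (∀ i, s i ≤ t i) ∧ (∀ i j, i < j → t i ≤ s j) ∧
    ∀ i, (dist (γ.toMap (s i) : EuclideanSpace ℝ (Fin d)) x ≤ r ∧
            R ≤ dist (γ.toMap (t i) : EuclideanSpace ℝ (Fin d)) x) ∨
         (R ≤ dist (γ.toMap (s i) : EuclideanSpace ℝ (Fin d)) x ∧
            dist (γ.toMap (t i) : EuclideanSpace ℝ (Fin d)) x ≤ r)

/-! ### Systems of random curves -/

/-- A system of random curves in `Λ` with short-distance cutoff `δ ∈ (0, δmax]`: for each `δ` a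
probability measure `μ δ` on configurations, almost surely consisting of polygonal paths of step
size `δ` whose local complexity is bounded uniformly (in the path, in `ω` and in `δ`). -/
def IsSystem {d : ℕ} {Λ : Set (EuclideanSpace ℝ (Fin d))} (δmax : ℝ)
    (μ : ℝ → Measure (Config Λ)) : Prop :=
  (∀ δ ∈ Ioc 0 δmax, IsProbabilityMeasure (μ δ)) ∧
  ∃ N : ℕ, ∀ δ ∈ Ioc 0 δmax, ∀ᵐ F ∂(μ δ), ∀ C ∈ F, IsPolygonal δ N C

/-- The hypothesis **H1**, the power bound on the probability of multiple crossings, with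
constants `K k` and exponents `lam k → ∞`. -/
def HypothesisH1 {d : ℕ} {Λ : Set (EuclideanSpace ℝ (Fin d))} (δmax : ℝ)
    (μ : ℝ → Measure (Config Λ)) (K lam : ℕ → ℝ) : Prop :=
  (∀ k : ℕ, 1 ≤ k → ∀ δ ∈ Ioc 0 δmax, ∀ (x : EuclideanSpace ℝ (Fin d)) (r R : ℝ),
    δ ≤ r → r < R → R ≤ 1 →
      μ δ {F | ∃ C ∈ F, Traversed C k x r R} ≤ ENNReal.ofReal (K k * (r / R) ^ lam k)) ∧
  Tendsto lam atTop atTop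

/-- The random variables `X δ` stay stochastically bounded as `δ → 0`. -/
def StochasticallyBounded {Ω : Type*} [MeasurableSpace Ω] (δmax : ℝ) (μ : ℝ → Measure Ω)
    (X : ℝ → Ω → ℝ) : Prop :=
  ∀ η : ℝ, 0 < η → ∃ u : ℝ, ∀ δ ∈ Ioc 0 δmax, μ δ {ω | u ≤ |X δ ω|} ≤ ENNReal.ofReal η

end

end RandomCurves

open RandomCurves

/-! A curve is Hölder of exponent `1/s` in some parametrization if, at each scale `r`, it splits
into at most about `r ^ (-a)` pieces of size `r`, with `a < s`. One builds a clock that charges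
every piece of every dyadic scale a fixed time; the total charge is a geometric series, and two
points further apart than a few `r` are separated by a complete piece, hence by its time. So the
matter is to count pieces, uniformly over the curves of a configuration.

Pieces are cut greedily (`cuts`). Cover `Λ` by about `ℓ⁻ᵈ` balls of radius `ℓ`, and cut at `r = 2 ℓ
^ (1 - β)`. A piece that starts in the ball about `x` and is then left crosses the shell from `ℓ` to
`ℓ ^ (1 - β)` about `x` (`traversed_of_subset_cuts`). By H1 with `k` so large that `β * lam k ≥ d +
1`, a union bound excludes `k` such crossings at all small scales above `δ` at once
(`NoMultipleCrossing`), so each ball starts at most `k` pieces. Moreover a ball that meets a curve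
of diameter at least `4R` is joined by it to distance `R` (`traversed_one_of_dist_le`). By H1 with
`k = 1` the mean number of such balls is of order `ℓ⁻ᵈ (ℓ/R) ^ lam 1`; Markov's inequality, with
small powers of the two scales given away for summability, bounds it at all pairs of scales
(`FewCrossed`). This yields `a` slightly above `d - lam 1`, and the dependence on the diameter
through `R`.

Below `δ` the path is linear. The bound on vertices per ball of radius `δ` limits the number of
steps in the same way, and half of the time, spent uniformly over the steps, gives a Lipschitz
estimate. `rpow_le_of_levels` joins the two regimes, and `exists_parametrization_rpow_le` assembles
the parametrization. -/

/-! ### Cutting a sequence of points into pieces of small diameter -/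

section Cuts

variable {X : Type*} [PseudoMetricSpace X]

/-- Starting point of the piece containing the index `j`, when a new piece is begun as soon as the
sequence leaves the closed ball of radius `r` about the starting point of the current piece. -/
noncomputable def lastCut (v : ℕ → X) (r : ℝ) : ℕ → ℕ
  | 0 => 0
  | j + 1 => open Classical in
      if r < dist (v (j + 1)) (v (lastCut v r j)) then j + 1 else lastCut v r j

/-- The steps `j → j + 1` at which a new piece is begun. -/
noncomputable def cuts (v : ℕ → X) (r : ℝ) (n : ℕ) : Finset ℕ := open Classical in
  (Finset.range n).filter fun j => r < dist (v (j + 1)) (v (lastCut v r j))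

theorem mem_cuts {v : ℕ → X} {r : ℝ} {n j : ℕ} :
    j ∈ cuts v r n ↔ j < n ∧ r < dist (v (j + 1)) (v (lastCut v r j)) := by
  classical
  simp [cuts]

theorem lastCut_le (v : ℕ → X) (r : ℝ) (j : ℕ) : lastCut v r j ≤ j := by
  induction j with
  | zero => simp [lastCut]
  | succ j ih => rw [lastCut]; split_ifs <;> omega

theorem dist_lastCut_le (v : ℕ → X) {r : ℝ} (hr : 0 ≤ r) (j : ℕ) :
    dist (v j) (v (lastCut v r j)) ≤ r := by
  induction j with
  | zero => simpa [lastCut] using hr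
  | succ j ih =>
    rw [lastCut]
    split_ifs with h
    · simpa using hr
    · exact not_lt.1 h

theorem lastCut_mono (v : ℕ → X) (r : ℝ) : Monotone (lastCut v r) := by
  refine monotone_nat_of_le_succ fun j => ?_
  have := lastCut_le v r j
  rw [lastCut]
  split_ifs <;> omega

/-- After a cut at `j` the next piece starts at `j + 1`. Hence the stretches from `lastCut v r j` to
`j + 1` belonging to different cuts do not overlap, which makes the crossings they produce separate.
-/
theorem lt_lastCut_of_mem_cuts {v : ℕ → X} {r : ℝ} {n j j' : ℕ} (hj : j ∈ cuts v r n)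
    (h : j < j') : j + 1 ≤ lastCut v r j' := by
  refine le_trans (le_of_eq ?_) (lastCut_mono v r (show j + 1 ≤ j' from h))
  rw [lastCut, if_pos (mem_cuts.1 hj).2]

/-- Without a cut in between, both points lie within `r` of the same starting point. -/
theorem exists_mem_cuts (v : ℕ → X) {r : ℝ} (hr : 0 ≤ r) {n i₁ i₂ : ℕ} (h : i₁ ≤ i₂) (hn : i₂ ≤ n)
    (hd : 2 * r < dist (v i₁) (v i₂)) : ∃ j ∈ cuts v r n, i₁ ≤ j ∧ j < i₂ := by
  by_contra! hcon
  have key : ∀ i, i₁ ≤ i → i ≤ i₂ → lastCut v r i = lastCut v r i₁ := by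
    intro i hi
    induction i, hi using Nat.le_induction with
    | base => simp
    | succ j hj ih =>
      intro hj2
      rw [lastCut, if_neg, ih (by omega)]
      intro hlt
      have := hcon j (mem_cuts.2 ⟨by omega, hlt⟩) hj
      omega
  have h1 := dist_lastCut_le v hr i₁
  have h2 := dist_lastCut_le v hr i₂
  rw [key i₂ h le_rfl] at h2
  have := dist_triangle_right (v i₁) (v i₂) (v (lastCut v r i₁))
  linarith

/-- If every ball of a finite family is left by the sequence to distance `r` fewer than `k` times,
then the number of cuts is at most `k` times the number of balls. -/
theorem card_cuts_le {v : ℕ → X} {r ℓ : ℝ} {n k : ℕ} (T : Finset X)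
    (hT : ∀ i ≤ n, ∃ x ∈ T, dist (v i) x ≤ ℓ)
    (hk : ∀ x ∈ T, ∀ P ⊆ cuts v r n, (∀ j ∈ P, dist (v (lastCut v r j)) x ≤ ℓ) → P.card ≤ k) :
    (cuts v r n).card ≤ k * T.card := by
  classical
  have : Nonempty X := ⟨v 0⟩
  have h1 : ∀ j ∈ cuts v r n, ∃ x ∈ T, dist (v (lastCut v r j)) x ≤ ℓ := fun j hj =>
    hT _ ((lastCut_le v r j).trans (mem_cuts.1 hj).1.le)
  choose! f hf1 hf2 using h1
  refine Finset.card_le_mul_card_image_of_maps_to (f := f) hf1 k fun x hx => ?_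
  refine hk x hx _ (Finset.filter_subset _ _) fun j hj => ?_
  rw [Finset.mem_filter] at hj
  exact hj.2 ▸ hf2 j hj.1

end Cuts

/-! ### Reparametrization of the unit interval -/

/-- The piecewise linear function which increases from `0` to `1` on `[0, 1]`. -/
noncomputable def ramp (x : ℝ) : ℝ := max 0 (min 1 x)

theorem ramp_mono : Monotone ramp := fun _ _ h => max_le_max le_rfl (min_le_min le_rfl h)

theorem continuous_ramp : Continuous ramp := by unfold ramp; fun_prop

theorem ramp_of_nonpos {x : ℝ} (h : x ≤ 0) : ramp x = 0 :=
  max_eq_left ((min_le_right _ _).trans h)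

theorem ramp_of_one_le {x : ℝ} (h : 1 ≤ x) : ramp x = 1 := by simp [ramp, min_eq_left h]

/-- The clock: `ψ` advances at a uniform rate, with total 1/2, and in addition by `w i` during step
`i`. Since the total is at most 1, normalizing only enlarges increments. The uniform part makes `ψ`
strictly increasing. -/
theorem exists_homeomorph_of_weights (n : ℕ) (w : ℕ → ℝ) (hw : ∀ i, 0 ≤ w i)
    (hs : ∑ i ∈ Finset.range n, w i ≤ 1 / 2) :
    ∃ ψ : I ≃ₜ I, StrictMono ψ ∧
      (∀ t₁ t₂ : I, t₁ ≤ t₂ → ((t₂ : ℝ) - t₁) / 2 ≤ (ψ t₂ : ℝ) - ψ t₁) ∧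
      ∀ t₁ t₂ : I, t₁ ≤ t₂ → ∀ j < n, (n : ℝ) * t₁ ≤ j → (j : ℝ) + 1 ≤ n * t₂ →
        w j ≤ (ψ t₂ : ℝ) - ψ t₁ := by
  set W : ℝ := 1 / 2 + ∑ i ∈ Finset.range n, w i with hW
  have hS0 : 0 ≤ ∑ i ∈ Finset.range n, w i := Finset.sum_nonneg fun i _ => hw i
  have hW0 : 0 < W := by linarith
  have hW1 : W ≤ 1 := by linarith
  set h : ℝ → ℝ := fun t => ∑ i ∈ Finset.range n, w i * ramp (n * t - i) with hh
  have hmono : Monotone h := fun a b hab => Finset.sum_le_sum fun i _ =>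
    mul_le_mul_of_nonneg_left (ramp_mono (by gcongr)) (hw i)
  set f : ℝ → ℝ := fun t => (t / 2 + h t) / W with hf
  have hcont : Continuous f := by
    have : Continuous h := continuous_finsetSum _ fun i _ =>
      continuous_const.mul (continuous_ramp.comp (by fun_prop))
    exact ((continuous_id.div_const 2).add this).div_const W
  have hstrict : StrictMono f := fun a b hab => by
    have := hmono hab.le
    exact div_lt_div_of_pos_right (by linarith) hW0
  have h0 : f 0 = 0 := by
    have : h 0 = 0 := Finset.sum_eq_zero fun i _ => by
      rw [ramp_of_nonpos (by simp), mul_zero]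
    simp [hf, this]
  have h1 : f 1 = 1 := by
    have : h 1 = ∑ i ∈ Finset.range n, w i := Finset.sum_congr rfl fun i hi => by
      have : (i : ℝ) + 1 ≤ n := by exact_mod_cast Finset.mem_range.1 hi
      rw [ramp_of_one_le (by linarith), mul_one]
    simp only [hf, this]
    exact div_self hW0.ne'
  have hI : ∀ t : I, f t ∈ I := fun t =>
    ⟨h0 ▸ hstrict.monotone t.2.1, h1 ▸ hstrict.monotone t.2.2⟩
  set g : I → I := fun t => ⟨f t, hI t⟩ with hg
  have hgmono : StrictMono g := fun a b hab => hstrict hab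
  have hgcont : Continuous g := (hcont.comp continuous_subtype_val).subtype_mk _
  have hgsurj : Function.Surjective g := fun y =>
    mem_range_of_exists_le_of_exists_ge hgcont
      ⟨0, Subtype.coe_le_coe.1 (by simpa [hg, h0] using y.2.1)⟩
      ⟨1, Subtype.coe_le_coe.1 (by simpa [hg, h1] using y.2.2)⟩
  have hdiff : ∀ t₁ t₂ : ℝ, t₁ ≤ t₂ → (t₂ - t₁) / 2 + (h t₂ - h t₁) ≤ f t₂ - f t₁ := by
    intro t₁ t₂ ht
    have e : f t₂ - f t₁ = ((t₂ - t₁) / 2 + (h t₂ - h t₁)) / W := by simp only [hf]; ring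
    rw [e, le_div_iff₀ hW0]
    have := hmono ht
    exact mul_le_of_le_one_right (by linarith) hW1
  refine ⟨(hgmono.orderIsoOfSurjective g hgsurj).toHomeomorph, hgmono, fun t₁ t₂ ht => ?_,
    fun t₁ t₂ ht j hj hj1 hj2 => ?_⟩
  · have h2 := hdiff t₁ t₂ ht
    have h3 := hmono (show (t₁ : ℝ) ≤ t₂ from ht)
    change _ ≤ f t₂ - f t₁
    linarith
  · have h2 := hdiff t₁ t₂ ht
    have h3 : (t₁ : ℝ) ≤ t₂ := ht
    have h4 : w j ≤ h t₂ - h t₁ := by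
      rw [hh]
      simp only [← Finset.sum_sub_distrib]
      have := Finset.single_le_sum (f := fun i => w i * ramp (n * t₂ - i) - w i * ramp (n * t₁ - i))
        (fun i _ => sub_nonneg.2 (mul_le_mul_of_nonneg_left (ramp_mono (by gcongr)) (hw i)))
        (Finset.mem_range.2 hj)
      refine le_trans (le_of_eq ?_) this
      rw [ramp_of_one_le (by linarith), ramp_of_nonpos (by linarith)]
      ring
    change _ ≤ f t₂ - f t₁
    linarith

/-! ### Polygonal paths -/

section Polygon

variable {E : Type*} [NormedAddCommGroup E] [NormedSpace ℝ E]

/-- `f` runs linearly, in time `1 / n` for each step, through `v 0, …, v n`. -/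
def RunsThrough (f : I → E) (n : ℕ) (v : ℕ → E) : Prop :=
  ∀ i < n, ∀ t : I, ∀ θ ∈ Icc (0 : ℝ) 1, (n : ℝ) * t = i + θ →
    f t = AffineMap.lineMap (v i) (v (i + 1)) θ

theorem exists_step {n : ℕ} (hn : 1 ≤ n) (t : I) :
    ∃ i < n, ∃ θ ∈ Icc (0 : ℝ) 1, (n : ℝ) * t = i + θ := by
  have hn0 : (0 : ℝ) < n := by exact_mod_cast hn
  have ht0 : 0 ≤ (n : ℝ) * t := mul_nonneg hn0.le t.2.1
  have ht1 : (n : ℝ) * t ≤ n := mul_le_of_le_one_right hn0.le t.2.2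
  rcases ht1.lt_or_eq with h | h
  · refine ⟨⌊(n : ℝ) * t⌋₊, (Nat.floor_lt ht0).2 h, (n : ℝ) * t - ⌊(n : ℝ) * t⌋₊,
      ⟨?_, ?_⟩, by ring⟩
    · linarith [Nat.floor_le ht0]
    · linarith [Nat.lt_floor_add_one ((n : ℝ) * t)]
  · refine ⟨n - 1, by omega, 1, ⟨zero_le_one, le_rfl⟩, ?_⟩
    rw [h, Nat.cast_sub hn]
    simp

/-- The time at which the vertex `i` of a path with `n` steps is visited. -/
noncomputable def vertexTime (n i : ℕ) : I :=
  Set.projIcc 0 1 zero_le_one ((i : ℝ) / n)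

theorem coe_vertexTime {n i : ℕ} (h : i ≤ n) : (vertexTime n i : ℝ) = (i : ℝ) / n := by
  have h1 : (i : ℝ) / n ∈ Icc (0 : ℝ) 1 :=
    ⟨by positivity, div_le_one_of_le₀ (by exact_mod_cast h) (by positivity)⟩
  rw [vertexTime, Set.projIcc_of_mem _ h1]

theorem vertexTime_mono (n : ℕ) : Monotone (vertexTime n) := fun i j h =>
  Set.monotone_projIcc _ (by gcongr)

theorem RunsThrough.apply_vertexTime {f : I → E} {n : ℕ} {v : ℕ → E} (hf : RunsThrough f n v)
    (hn : 1 ≤ n) {i : ℕ} (h : i ≤ n) : f (vertexTime n i) = v i := by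
  have hn0 : (n : ℝ) ≠ 0 := by positivity
  have e : (n : ℝ) * vertexTime n i = i := by rw [coe_vertexTime h]; field_simp
  rcases h.lt_or_eq with h | h
  · rw [hf i h (vertexTime n i) 0 ⟨le_rfl, zero_le_one⟩ (by rw [e]; simp)]
    simp
  · rw [hf (n - 1) (by omega) (vertexTime n i) 1 ⟨zero_le_one, le_rfl⟩
      (by rw [e, Nat.cast_sub hn, h]; simp), Nat.sub_add_cancel hn, h]
    simp

variable {f : I → E} {n : ℕ} {v : ℕ → E} {δ : ℝ}

theorem dist_lineMap_right_le {a b : E} {δ θ : ℝ} (hab : dist a b ≤ δ)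
    (hθ : θ ∈ Icc (0 : ℝ) 1) : dist (AffineMap.lineMap a b θ) b ≤ (1 - θ) * δ := by
  rw [dist_lineMap_right, Real.norm_eq_abs, abs_of_nonneg (by linarith [hθ.2])]
  exact mul_le_mul_of_nonneg_left hab (by linarith [hθ.2])

theorem dist_lineMap_left_le {a b : E} {δ θ : ℝ} (hab : dist a b ≤ δ)
    (hθ : θ ∈ Icc (0 : ℝ) 1) : dist a (AffineMap.lineMap a b θ) ≤ θ * δ := by
  rw [dist_left_lineMap, Real.norm_eq_abs, abs_of_nonneg hθ.1]
  exact mul_le_mul_of_nonneg_left hab hθ.1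

theorem RunsThrough.dist_le (hf : RunsThrough f n v) (hn : 1 ≤ n)
    (hv : ∀ i < n, dist (v i) (v (i + 1)) ≤ δ) {t₁ t₂ : I} (ht : t₁ ≤ t₂) :
    dist (f t₁) (f t₂) ≤ n * δ * ((t₂ : ℝ) - t₁) := by
  have hn0 : (0 : ℝ) < n := by exact_mod_cast hn
  have ht' : (t₁ : ℝ) ≤ t₂ := ht
  obtain ⟨i₁, hi₁, θ₁, hθ₁, e₁⟩ := exists_step hn t₁
  obtain ⟨i₂, hi₂, θ₂, hθ₂, e₂⟩ := exists_step hn t₂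
  have hle : (n : ℝ) * t₁ ≤ n * t₂ := by gcongr
  rw [show (n : ℝ) * δ * ((t₂ : ℝ) - t₁) = (n * t₂ - n * t₁) * δ by ring]
  rcases lt_trichotomy i₁ i₂ with h | h | h
  · have a₁ := dist_lineMap_right_le (hv i₁ hi₁) hθ₁
    have a₂ := dist_lineMap_left_le (hv i₂ hi₂) hθ₂
    have a₃ : dist (v (i₁ + 1)) (v i₂) ≤ ∑ i ∈ Finset.Ico (i₁ + 1) i₂, δ :=
      dist_le_Ico_sum_of_dist_le (show i₁ + 1 ≤ i₂ from h) fun {k} _ hk => hv k (hk.trans hi₂)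
    rw [Finset.sum_const, Nat.card_Ico, nsmul_eq_mul, Nat.cast_sub (show i₁ + 1 ≤ i₂ from h)] at a₃
    push_cast at a₃
    rw [hf i₁ hi₁ t₁ θ₁ hθ₁ e₁, hf i₂ hi₂ t₂ θ₂ hθ₂ e₂, e₁, e₂]
    have := dist_triangle4 (AffineMap.lineMap (v i₁) (v (i₁ + 1)) θ₁) (v (i₁ + 1)) (v i₂)
      (AffineMap.lineMap (v i₂) (v (i₂ + 1)) θ₂)
    linarith
  · subst h
    rw [hf i₁ hi₁ t₁ θ₁ hθ₁ e₁, hf i₁ hi₂ t₂ θ₂ hθ₂ e₂, e₁, e₂, dist_lineMap_lineMap,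
      dist_comm, Real.dist_eq, abs_of_nonneg (by linarith)]
    have := mul_le_mul_of_nonneg_left (hv i₁ hi₁) (show 0 ≤ θ₂ - θ₁ by linarith)
    linarith
  · have h' : (i₂ : ℝ) + 1 ≤ i₁ := by exact_mod_cast h
    have : (t₁ : ℝ) = t₂ := by
      apply mul_left_cancel₀ hn0.ne'
      linarith [hθ₁.1, hθ₂.2]
    rw [Subtype.ext this]
    simp

/-- A path running through `v 0, …, v n` makes a cut at level `r` between any two times at which
its positions are sufficiently far apart. -/
theorem RunsThrough.exists_mem_cuts (hf : RunsThrough f n v) (hn : 1 ≤ n)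
    (hv : ∀ i < n, dist (v i) (v (i + 1)) ≤ δ) {r : ℝ} (hr : 0 ≤ r) {t₁ t₂ : I} (ht : t₁ ≤ t₂)
    (hd : 2 * r + 2 * δ < dist (f t₁) (f t₂)) :
    ∃ j ∈ cuts v r n, (n : ℝ) * t₁ ≤ j ∧ (j : ℝ) + 1 ≤ n * t₂ := by
  obtain ⟨i₁, hi₁, θ₁, hθ₁, e₁⟩ := exists_step hn t₁
  obtain ⟨i₂, hi₂, θ₂, hθ₂, e₂⟩ := exists_step hn t₂
  have hδ : 0 ≤ δ := dist_nonneg.trans (hv 0 (by omega))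
  rcases lt_or_ge i₁ i₂ with h | h
  · have a₁ := dist_lineMap_right_le (hv i₁ hi₁) hθ₁
    have a₂ := dist_lineMap_left_le (hv i₂ hi₂) hθ₂
    rw [hf i₁ hi₁ t₁ θ₁ hθ₁ e₁, hf i₂ hi₂ t₂ θ₂ hθ₂ e₂] at hd
    have := dist_triangle4 (AffineMap.lineMap (v i₁) (v (i₁ + 1)) θ₁) (v (i₁ + 1)) (v i₂)
      (AffineMap.lineMap (v i₂) (v (i₂ + 1)) θ₂)
    have b₁ : (1 - θ₁) * δ ≤ δ := mul_le_of_le_one_left hδ (by linarith [hθ₁.1])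
    have b₂ : θ₂ * δ ≤ δ := mul_le_of_le_one_left hδ hθ₂.2
    -- Moving inward to the vertices `i₁ + 1` and `i₂` costs at most `2 * δ` and ensures that the
    -- whole cut step lies between the two times.
    obtain ⟨j, hj, h1, h2⟩ := _root_.exists_mem_cuts v hr (show i₁ + 1 ≤ i₂ from h) hi₂.le
      (by linarith)
    refine ⟨j, hj, ?_, ?_⟩
    · have : (i₁ : ℝ) + 1 ≤ j := by exact_mod_cast h1
      linarith [hθ₁.2]
    · have : (j : ℝ) + 1 ≤ i₂ := by exact_mod_cast h2
      linarith [hθ₂.1]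
  · have h' : (i₂ : ℝ) ≤ i₁ := by exact_mod_cast h
    have := hf.dist_le hn hv ht
    have e : (n : ℝ) * δ * ((t₂ : ℝ) - t₁) = (n * t₂ - n * t₁) * δ := by ring
    have : (n * t₂ - n * t₁ : ℝ) * δ ≤ 1 * δ :=
      mul_le_mul_of_nonneg_right (by linarith [hθ₁.1, hθ₂.2]) hδ
    linarith

/-- A step is charged `p m` for every level `m ∈ J` at which it is a cut; summing over levels first
shows that `hsum` bounds the total charge. -/
theorem RunsThrough.exists_homeomorph (hf : RunsThrough f n v) (hn : 1 ≤ n)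
    (hv : ∀ i < n, dist (v i) (v (i + 1)) ≤ δ) (J : Finset ℕ) (r p : ℕ → ℝ)
    (hr : ∀ m, 0 ≤ r m) (hp : ∀ m, 0 ≤ p m)
    (hsum : ∑ m ∈ J, p m * (cuts v (r m) n).card ≤ 1 / 2) :
    ∃ ψ : I ≃ₜ I, StrictMono ψ ∧
      (∀ t₁ t₂ : I, t₁ ≤ t₂ → ((t₂ : ℝ) - t₁) / 2 ≤ (ψ t₂ : ℝ) - ψ t₁) ∧
      ∀ t₁ t₂ : I, t₁ ≤ t₂ → ∀ m ∈ J, 2 * r m + 2 * δ < dist (f t₁) (f t₂) →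
        p m ≤ (ψ t₂ : ℝ) - ψ t₁ := by
  classical
  set w : ℕ → ℝ := fun j => ∑ m ∈ J, if j ∈ cuts v (r m) n then p m else 0 with hw
  have hterm : ∀ j m, 0 ≤ if j ∈ cuts v (r m) n then p m else 0 := fun j m => by
    split_ifs
    exacts [hp m, le_rfl]
  obtain ⟨ψ, h1, h2, h3⟩ := exists_homeomorph_of_weights n w
    (fun j => Finset.sum_nonneg fun m _ => hterm j m) (by
      refine le_trans (le_of_eq ?_) hsum
      rw [hw, Finset.sum_comm]
      refine Finset.sum_congr rfl fun m _ => ?_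
      rw [Finset.sum_ite_mem, Finset.sum_const, nsmul_eq_mul, mul_comm,
        Finset.inter_eq_right.2 fun j hj => Finset.mem_range.2 (mem_cuts.1 hj).1])
  refine ⟨ψ, h1, h2, fun t₁ t₂ ht m hm hd => ?_⟩
  obtain ⟨j, hj, a, b⟩ := hf.exists_mem_cuts hn hv (hr m) ht hd
  refine le_trans ?_ (h3 t₁ t₂ ht j (mem_cuts.1 hj).1 a b)
  have := Finset.single_le_sum (f := fun m => if j ∈ cuts v (r m) n then p m else 0)
    (fun m _ => hterm j m) hm
  simpa only [if_pos hj] using this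

end Polygon

/-! ### Crossings of shells by polygonal paths -/

section Crossings

variable {d : ℕ} {Λ : Set (EuclideanSpace ℝ (Fin d))} {C : Curve Λ} {γ : ParamCurve Λ} {n : ℕ}
  {v : ℕ → EuclideanSpace ℝ (Fin d)}

/-- A piece starting within `ℓ` of `x` ends, at its cut, further than `r` from its start, hence
further than `r - ℓ ≥ R` from `x`. -/
theorem traversed_of_subset_cuts (hC : Parametrizes γ C)
    (hf : RunsThrough (fun t => (γ.toMap t : EuclideanSpace ℝ (Fin d))) n v) (hn : 1 ≤ n)
    {r ℓ R : ℝ} {k : ℕ} {x : EuclideanSpace ℝ (Fin d)} {P : Finset ℕ} (hP : P ⊆ cuts v r n)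
    (hk : k ≤ P.card) (hx : ∀ j ∈ P, dist (v (lastCut v r j)) x ≤ ℓ) (hR : R + ℓ ≤ r) :
    Traversed C k x ℓ R := by
  set e := P.orderEmbOfCardLe hk
  have he : ∀ i, e i ∈ P := fun i => P.orderEmbOfCardLe_mem hk i
  have hlt : ∀ i, e i < n := fun i => (mem_cuts.1 (hP (he i))).1
  refine ⟨γ, hC, fun i => vertexTime n (lastCut v r (e i)), fun i => vertexTime n (e i + 1),
    fun i => vertexTime_mono n ((lastCut_le v r _).trans (Nat.le_succ _)),
    fun i j hij => vertexTime_mono n (lt_lastCut_of_mem_cuts (hP (he i)) (e.strictMono hij)),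
    fun i => Or.inl ?_⟩
  have h1 := hf.apply_vertexTime hn ((lastCut_le v r (e i)).trans (hlt i).le)
  have h2 := hf.apply_vertexTime hn (show e i + 1 ≤ n from hlt i)
  have h3 := (mem_cuts.1 (hP (he i))).2
  have h4 := hx _ (he i)
  rw [h1, h2]
  refine ⟨h4, ?_⟩
  have := dist_triangle_right (v (e i + 1)) (v (lastCut v r (e i))) x
  linarith

/-- A curve staying within `R` of `x` would have diameter at most `2 * R`, so some point is at
distance at least `R`; it may come before or after time `a`. -/
theorem traversed_one_of_dist_le (hC : Parametrizes γ C) {ℓ R : ℝ} (hR0 : 0 < R)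
    (hR : 4 * R ≤ Metric.diam (range γ.toMap)) {x : EuclideanSpace ℝ (Fin d)} {a : I}
    (ha : dist (γ.toMap a : EuclideanSpace ℝ (Fin d)) x ≤ ℓ) : Traversed C 1 x ℓ R := by
  obtain ⟨b, hb⟩ : ∃ b : I, R ≤ dist (γ.toMap b : EuclideanSpace ℝ (Fin d)) x := by
    by_contra! h
    have : Metric.diam (range γ.toMap) ≤ 2 * R := by
      refine Metric.diam_le_of_forall_dist_le (by linarith) ?_
      rintro _ ⟨p, rfl⟩ _ ⟨q, rfl⟩
      have h1 := h p
      have h2 := h q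
      have := dist_triangle_right (γ.toMap p : EuclideanSpace ℝ (Fin d)) (γ.toMap q) x
      rw [Subtype.dist_eq]
      linarith
    linarith
  rcases le_total a b with h | h
  · exact ⟨γ, hC, fun _ => a, fun _ => b, fun _ => h,
      fun i j hij => absurd hij (by rw [Subsingleton.elim i j]; exact lt_irrefl _),
      fun _ => Or.inl ⟨ha, hb⟩⟩
  · exact ⟨γ, hC, fun _ => b, fun _ => a, fun _ => h,
      fun i j hij => absurd hij (by rw [Subsingleton.elim i j]; exact lt_irrefl _),
      fun _ => Or.inr ⟨hb, ha⟩⟩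

end Crossings

/-! ### Nets in bounded sets -/

/-- Finite sets `T ℓ` of at most `B ℓ⁻ᵈ` points which are `ℓ`-dense in `Λ`. -/
def IsNetFamily {d : ℕ} (Λ : Set (EuclideanSpace ℝ (Fin d))) (B : ℝ)
    (T : ℝ → Finset (EuclideanSpace ℝ (Fin d))) : Prop :=
  ∀ ℓ ∈ Ioc (0 : ℝ) 1, ((T ℓ).card : ℝ) ≤ B * (ℓ⁻¹) ^ d ∧ ∀ y ∈ Λ, ∃ x ∈ T ℓ, dist y x ≤ ℓ

theorem exists_isNetFamily {d : ℕ} {Λ : Set (EuclideanSpace ℝ (Fin d))}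
    (hΛ : Bornology.IsBounded Λ) : ∃ B T, 0 < B ∧ IsNetFamily Λ B T := by
  classical
  obtain ⟨b, hb0, hb⟩ := hΛ.subset_closedBall_lt 0 0
  have key : ∀ ℓ ∈ Ioc (0 : ℝ) 1, ∃ T : Finset (EuclideanSpace ℝ (Fin d)),
      (T.card : ℝ) ≤ (2 * b * (d + 1) + 4) ^ d * (ℓ⁻¹) ^ d ∧ ∀ y ∈ Λ, ∃ x ∈ T, dist y x ≤ ℓ := by
    intro ℓ hℓ
    -- The net is a cubic grid of mesh `h`; any mesh with `d * h ^ 2 ≤ ℓ ^ 2` would do, and `d + 1`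
    -- is nonzero also for `d = 0`.
    set h : ℝ := ℓ / (d + 1) with hh
    have hh0 : 0 < h := div_pos hℓ.1 (by positivity)
    set M : ℕ := ⌈b / h⌉₊ with hM
    have hM1 : b / h ≤ M := Nat.le_ceil _
    have hM2 : (M : ℝ) < b / h + 1 := Nat.ceil_lt_add_one (by positivity)
    refine ⟨(Fintype.piFinset fun _ : Fin d => Finset.Icc (-(M : ℤ) - 1) M).image
      fun z => WithLp.toLp 2 fun i => h * (z i : ℝ), ?_, fun y hy => ?_⟩
    · have h1 : (2 * M + 2 : ℝ) ≤ (2 * b * (d + 1) + 4) * ℓ⁻¹ := by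
        have e : b / h = b * (d + 1) * ℓ⁻¹ := by rw [hh]; field_simp
        have : 1 ≤ ℓ⁻¹ := (one_le_inv₀ hℓ.1).2 hℓ.2
        rw [e] at hM2
        linarith
      calc _ ≤ (((Fintype.piFinset fun _ : Fin d => Finset.Icc (-(M : ℤ) - 1) M).card : ℕ) : ℝ) := by
            exact_mod_cast Finset.card_image_le
        _ = (2 * M + 2 : ℝ) ^ d := by
            rw [Fintype.card_piFinset_const, Int.card_Icc]
            have : ((M : ℤ) + 1 - (-(M : ℤ) - 1)).toNat = 2 * M + 2 := by omega
            rw [this]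
            push_cast
            simp
        _ ≤ _ := by
            rw [← mul_pow]
            gcongr
    · refine ⟨_, Finset.mem_image_of_mem _ (a := fun i => ⌊y i / h⌋)
        (Fintype.mem_piFinset.2 fun i => ?_), ?_⟩
      · have hyi : |y i| ≤ b := by
          have h1 : ‖y‖ ≤ b := by simpa using hb hy
          have := PiLp.norm_apply_le y i
          rw [Real.norm_eq_abs] at this
          linarith
        rw [abs_le] at hyi
        rw [Finset.mem_Icc]
        constructor
        · have : (-(M : ℤ)) ≤ ⌊y i / h⌋ := by
            rw [Int.le_floor]
            push_cast
            have : -(b / h) ≤ y i / h := by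
              rw [← neg_div]
              exact div_le_div_of_nonneg_right hyi.1 hh0.le
            linarith
          omega
        · have : (⌊y i / h⌋ : ℝ) ≤ (M : ℝ) := (Int.floor_le _).trans
            ((div_le_div_of_nonneg_right hyi.2 hh0.le).trans hM1)
          exact_mod_cast this
      · rw [EuclideanSpace.dist_eq]
        refine Real.sqrt_le_iff.2 ⟨hℓ.1.le, ?_⟩
        calc _ ≤ ∑ _i : Fin d, h ^ 2 := by
              refine Finset.sum_le_sum fun i _ => ?_
              rw [Real.dist_eq, sq_abs]
              have h1 := Int.floor_le (y i / h)
              have h2 := Int.lt_floor_add_one (y i / h)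
              rw [le_div_iff₀ hh0] at h1
              rw [div_lt_iff₀ hh0] at h2
              simp only
              refine pow_le_pow_left₀ (by nlinarith) (by nlinarith) 2
          _ = d * h ^ 2 := by simp
          _ ≤ (d + 1) ^ 2 * h ^ 2 := by
              gcongr
              nlinarith [(Nat.cast_nonneg d : (0 : ℝ) ≤ d)]
          _ = ℓ ^ 2 := by rw [hh]; field_simp
  choose! T hT using key
  exact ⟨_, T, by positivity, fun ℓ hℓ => hT ℓ hℓ⟩

/-! ### Probability estimates -/

/-- It suffices to bound the outer measures of the events that a given constant fails. -/
theorem exists_stochasticallyBounded {Ω : Type*} [MeasurableSpace Ω] {δmax : ℝ}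
    {μ : ℝ → Measure Ω} (Bad : ℝ → ℕ → Set Ω)
    (h : ∀ η : ℝ, 0 < η → ∃ u : ℕ, ∀ δ ∈ Ioc 0 δmax, μ δ (Bad δ u) ≤ ENNReal.ofReal η) :
    ∃ κ : ℝ → Ω → ℝ, (∀ δ, Measurable (κ δ)) ∧ StochasticallyBounded δmax μ κ ∧
      ∀ δ ∈ Ioc 0 δmax, ∀ᵐ F ∂(μ δ), ∃ u : ℕ, κ δ F = u ∧ F ∉ Bad δ u := by
  classical
  -- The bad events need not be measurable; their measurable hulls have the same measure and make
  -- `κ`, the first `u` outside the hulls, measurable.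
  set H : ℝ → ℕ → Set Ω := fun δ u => toMeasurable (μ δ) (Bad δ u) with hH
  have hHm : ∀ δ u, MeasurableSet (H δ u) := fun δ u => measurableSet_toMeasurable _ _
  -- The second alternative gives `κ` the value 0 on the null set where every hull is hit.
  set p : ℝ → Ω → ℕ → Prop := fun δ F u => F ∉ H δ u ∨ F ∈ ⋂ u, H δ u with hp
  have hex : ∀ δ F, ∃ u, p δ F u := by
    intro δ F
    by_cases hF : F ∈ ⋂ u, H δ u
    · exact ⟨0, Or.inr hF⟩
    · simp only [mem_iInter, not_forall] at hF
      exact hF.imp fun u hu => Or.inl hu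
  refine ⟨fun δ F => (Nat.find (hex δ F) : ℝ), fun δ => ?_, fun η hη => ?_, fun δ hδ => ?_⟩
  · exact (measurable_from_nat (f := fun u : ℕ => (u : ℝ))).comp (measurable_find (hex δ)
      fun u => (hHm δ u).compl.union (MeasurableSet.iInter (hHm δ)))
  · obtain ⟨u, hu⟩ := h η hη
    refine ⟨u + 1, fun δ hδ => le_trans (measure_mono ?_)
      ((measure_toMeasurable (μ := μ δ) (Bad δ u)).le.trans (hu δ hδ))⟩
    intro F hF
    have hF' : u + 1 ≤ Nat.find (hex δ F) := by
      have : ((u : ℝ) + 1) ≤ |(Nat.find (hex δ F) : ℝ)| := hF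
      rw [Nat.abs_cast] at this
      exact_mod_cast this
    have := Nat.find_min (hex δ F) (show u < Nat.find (hex δ F) from hF')
    by_contra hcon
    exact this (Or.inl hcon)
  · have hnull : μ δ (⋂ u, H δ u) = 0 := by
      refine le_antisymm (ENNReal.le_of_forall_pos_le_add fun η hη _ => ?_) zero_le
      obtain ⟨u, hu⟩ := h η hη
      rw [zero_add]
      refine (measure_mono (iInter_subset _ u)).trans ?_
      rw [hH, measure_toMeasurable]
      simpa using hu δ hδ
    filter_upwards [measure_eq_zero_iff_ae_notMem.1 hnull] with F hF
    refine ⟨_, rfl, fun hB => ?_⟩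
    rcases Nat.find_spec (hex δ F) with h1 | h1
    · exact h1 (subset_toMeasurable _ _ hB)
    · exact hF h1

/-- Markov's inequality for the number of events of a finite family that occur. -/
theorem measure_le_card_filter {Ω ι : Type*} [MeasurableSpace Ω] (μ : Measure Ω) (T : Finset ι)
    (A : ι → Set Ω) [∀ F, DecidablePred fun x => F ∈ A x] {a c : ℝ} (hc : 0 < c)
    (h : ∀ x ∈ T, μ (A x) ≤ ENNReal.ofReal a) :
    μ {F | c ≤ (T.filter fun x => F ∈ A x).card} ≤ ENNReal.ofReal (T.card * a / c) := by
  set f : Ω → ℝ≥0∞ := fun F => ∑ x ∈ T, (toMeasurable μ (A x)).indicator 1 F with hf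
  have hfm : Measurable f := Finset.measurable_fun_sum _ fun x _ =>
    measurable_one.indicator (measurableSet_toMeasurable _ _)
  have hint : ∫⁻ F, f F ∂μ ≤ ENNReal.ofReal (T.card * a) := by
    rw [hf, lintegral_finsetSum _ fun x _ =>
      measurable_one.indicator (measurableSet_toMeasurable _ _)]
    calc _ = ∑ x ∈ T, μ (A x) := Finset.sum_congr rfl fun x _ => by
          rw [lintegral_indicator_one (measurableSet_toMeasurable _ _), measure_toMeasurable]
      _ ≤ ∑ _x ∈ T, ENNReal.ofReal a := Finset.sum_le_sum h
      _ = _ := by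
          rw [Finset.sum_const, nsmul_eq_mul, ENNReal.ofReal_mul (by positivity),
            ENNReal.ofReal_natCast]
  have hsub : {F | c ≤ (T.filter fun x => F ∈ A x).card} ⊆ {F | ENNReal.ofReal c ≤ f F} := by
    intro F hF
    have hF' : c ≤ (T.filter fun x => F ∈ A x).card := hF
    refine (ENNReal.ofReal_le_ofReal hF').trans ?_
    rw [ENNReal.ofReal_natCast, Finset.card_filter, Nat.cast_sum]
    refine Finset.sum_le_sum fun x _ => ?_
    split_ifs with hx
    · rw [indicator_of_mem (subset_toMeasurable _ _ hx)]
      simp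
    · simp
  refine (measure_mono hsub).trans ?_
  rw [ENNReal.ofReal_div_of_pos hc]
  refine (meas_ge_le_lintegral_div hfm.aemeasurable (by simpa using hc) (by simp)).trans ?_
  exact ENNReal.div_le_div_right hint _

section Bounds

variable {d : ℕ} {Λ : Set (EuclideanSpace ℝ (Fin d))} {δmax : ℝ} {μ : ℝ → Measure (Config Λ)}
  {K lam : ℕ → ℝ} {B : ℝ} {T : ℝ → Finset (EuclideanSpace ℝ (Fin d))}

open Classical in
/-- The number of points `x` of `T` such that a curve of `F` traverses the shell `D(x; ℓ, R)`. -/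
noncomputable def crossedCount (T : Finset (EuclideanSpace ℝ (Fin d))) (F : Config Λ) (ℓ R : ℝ) :
    ℕ :=
  (T.filter fun x => ∃ C ∈ F, Traversed C 1 x ℓ R).card

/-- At all scales `2⁻ⁿ` not much below `δ`, the numbers of points of the net at which the curves
of `F` make a crossing to distance `2⁻ᵐ` are of the order suggested by their mean values. -/
def FewCrossed (T : ℝ → Finset (EuclideanSpace ℝ (Fin d))) (δ a b u : ℝ) (F : Config Λ) : Prop :=
  ∀ n m : ℕ, δ ≤ 2 * ((2 : ℝ) ^ n)⁻¹ →
    (crossedCount (T (max δ ((2 : ℝ) ^ n)⁻¹)) F (max δ ((2 : ℝ) ^ n)⁻¹) ((2 : ℝ) ^ m)⁻¹ : ℝ) ≤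
      u * ((2 : ℝ) ^ n) ^ a * ((2 : ℝ) ^ m) ^ b

/-- At all scales between `δ` and `2⁻ⁿ⁰`, no curve of `F` crosses `k` times any of the shells about
the points of the net, whose inner radius `ℓ` and outer radius `ℓ ^ (1 - β)`. -/
def NoMultipleCrossing (T : ℝ → Finset (EuclideanSpace ℝ (Fin d))) (δ β : ℝ) (k n₀ : ℕ)
    (F : Config Λ) : Prop :=
  ∀ n ≥ n₀, δ ≤ ((2 : ℝ) ^ n)⁻¹ → ∀ x ∈ T ((2 : ℝ) ^ n)⁻¹,
    ¬ ∃ C ∈ F, Traversed C k x ((2 : ℝ) ^ n)⁻¹ (((2 : ℝ) ^ n)⁻¹ ^ (1 - β))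

theorem two_rpow_neg_lt_one {a : ℝ} (ha : 0 < a) : (2 : ℝ) ^ (-a) < 1 :=
  Real.rpow_lt_one_of_one_lt_of_neg one_lt_two (by linarith)

theorem two_pow_rpow_neg (n : ℕ) (a : ℝ) : ((2 : ℝ) ^ n) ^ (-a) = ((2 : ℝ) ^ (-a)) ^ n := by
  rw [← Real.rpow_natCast, ← Real.rpow_natCast, ← Real.rpow_mul zero_le_two,
    ← Real.rpow_mul zero_le_two, mul_comm]

theorem card_net_le (hT : IsNetFamily Λ B T) (hB : 0 < B) {δ : ℝ} (hδ1 : δ ≤ 1)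
    (n : ℕ) : ((T (max δ ((2 : ℝ) ^ n)⁻¹)).card : ℝ) ≤ B * ((2 : ℝ) ^ n) ^ d := by
  have hL : 0 < ((2 : ℝ) ^ n)⁻¹ := by positivity
  have hL1 : ((2 : ℝ) ^ n)⁻¹ ≤ 1 := inv_le_one_of_one_le₀ (one_le_pow₀ one_le_two)
  refine (hT _ ⟨lt_max_of_lt_right hL, max_le hδ1 hL1⟩).1.trans ?_
  gcongr
  rw [inv_le_comm₀ (lt_max_of_lt_right hL) (by positivity)]
  exact le_max_right _ _

theorem crossedCount_le_card (T : Finset (EuclideanSpace ℝ (Fin d))) (F : Config Λ) (ℓ R : ℝ) :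
    crossedCount T F ℓ R ≤ T.card := by
  classical exact Finset.card_filter_le _ _

/-- Covers the pairs of scales where H1 is void (inner radius not below the outer one) or `l = 0`:
the size of the net suffices, as `2 ^ n ≤ 2 * 2 ^ m` lets `l` powers pass from one factor to the
other. -/
theorem crossedCount_le_of_trivial (hT : IsNetFamily Λ B T) (hB : 0 < B) {δ : ℝ} (hδ1 : δ ≤ 1)
    {l ε : ℝ} (hl : 0 ≤ l) (hε : 0 < ε) (F : Config Λ) {n m : ℕ}
    (hδ : δ ≤ 2 * ((2 : ℝ) ^ n)⁻¹)
    (h : l = 0 ∨ ((2 : ℝ) ^ m)⁻¹ ≤ max δ ((2 : ℝ) ^ n)⁻¹) :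
    (crossedCount (T (max δ ((2 : ℝ) ^ n)⁻¹)) F (max δ ((2 : ℝ) ^ n)⁻¹) ((2 : ℝ) ^ m)⁻¹ : ℝ) ≤
      B * 2 ^ l * ((2 : ℝ) ^ n) ^ (d - l + ε / 4) * ((2 : ℝ) ^ m) ^ (l * (1 + ε)) := by
  have hn1 : 1 ≤ (2 : ℝ) ^ n := one_le_pow₀ one_le_two
  have hm1 : 1 ≤ (2 : ℝ) ^ m := one_le_pow₀ one_le_two
  have h1 : ((2 : ℝ) ^ n) ^ l ≤ 2 ^ l * ((2 : ℝ) ^ m) ^ (l * (1 + ε)) := by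
    rcases h with h | h
    · simp [h]
    · have h2 : ((2 : ℝ) ^ m)⁻¹ ≤ 2 * ((2 : ℝ) ^ n)⁻¹ :=
        h.trans (max_le hδ (by linarith [inv_pos.2 (show 0 < (2 : ℝ) ^ n by positivity)]))
      have h3 : (2 : ℝ) ^ n ≤ 2 * 2 ^ m := by
        rw [← div_eq_mul_inv, inv_le_comm₀ (by positivity) (by positivity), inv_div,
          div_le_iff₀ two_pos] at h2
        linarith
      calc ((2 : ℝ) ^ n) ^ l ≤ (2 * 2 ^ m) ^ l := Real.rpow_le_rpow (by positivity) h3 hl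
        _ = 2 ^ l * ((2 : ℝ) ^ m) ^ l := Real.mul_rpow zero_le_two (by positivity)
        _ ≤ _ := by
          gcongr
          nlinarith
  calc _ ≤ ((T (max δ ((2 : ℝ) ^ n)⁻¹)).card : ℝ) := by exact_mod_cast crossedCount_le_card _ _ _ _
    _ ≤ B * ((2 : ℝ) ^ n) ^ d := card_net_le hT hB hδ1 n
    _ = B * (((2 : ℝ) ^ n) ^ (d - l) * ((2 : ℝ) ^ n) ^ l) := by
      rw [← Real.rpow_add (by positivity), sub_add_cancel, Real.rpow_natCast]
    _ ≤ B * (((2 : ℝ) ^ n) ^ (d - l + ε / 4) * (2 ^ l * ((2 : ℝ) ^ m) ^ (l * (1 + ε)))) := by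
      gcongr
      linarith
    _ = _ := by ring

/-- Markov's inequality: the mean is at most about `2 ^ (n * (d - lam 1)) * 2 ^ (m * lam 1)`, and
the excess exponents `ε / 4` and `lam 1 * ε` in the threshold become the geometric factors. -/
theorem measure_crossedCount_ge_le (hT : IsNetFamily Λ B T) (hB : 0 < B) (hδ1 : δmax ≤ 1)
    (hH1 : HypothesisH1 δmax μ K lam) {δ : ℝ} (hδ : δ ∈ Ioc 0 δmax) (hl : 0 ≤ lam 1) (ε : ℝ)
    {u : ℝ} (hu : 0 < u) {n m : ℕ} (hδn : δ ≤ 2 * ((2 : ℝ) ^ n)⁻¹)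
    (h : max δ ((2 : ℝ) ^ n)⁻¹ < ((2 : ℝ) ^ m)⁻¹) :
    μ δ {F | u * ((2 : ℝ) ^ n) ^ (d - lam 1 + ε / 4) * ((2 : ℝ) ^ m) ^ (lam 1 * (1 + ε)) ≤
        (crossedCount (T (max δ ((2 : ℝ) ^ n)⁻¹)) F (max δ ((2 : ℝ) ^ n)⁻¹) ((2 : ℝ) ^ m)⁻¹ : ℝ)} ≤
      ENNReal.ofReal (B * |K 1| * 2 ^ lam 1 / u *
        (((2 : ℝ) ^ (-(ε / 4))) ^ n * ((2 : ℝ) ^ (-(lam 1 * ε))) ^ m)) := by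
  classical
  set ℓ := max δ ((2 : ℝ) ^ n)⁻¹ with hℓ
  set L := (2 : ℝ) ^ n with hL
  set M := (2 : ℝ) ^ m with hM
  have hL0 : 0 < L := by positivity
  have hM0 : 0 < M := by positivity
  have hM1 : M⁻¹ ≤ 1 := inv_le_one_of_one_le₀ (one_le_pow₀ one_le_two)
  have hℓ0 : 0 < ℓ := lt_max_of_lt_left hδ.1
  have hℓ2 : ℓ ≤ 2 * L⁻¹ := max_le hδn (by linarith [inv_pos.2 hL0])
  have hprob : ∀ x ∈ T ℓ, μ δ {F | ∃ C ∈ F, Traversed C 1 x ℓ M⁻¹} ≤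
      ENNReal.ofReal (|K 1| * (2 * L⁻¹ * M) ^ lam 1) := by
    intro x _
    refine (hH1.1 1 le_rfl δ hδ x ℓ M⁻¹ (le_max_left _ _) h hM1).trans
      (ENNReal.ofReal_le_ofReal ?_)
    rw [div_inv_eq_mul]
    have : (ℓ * M) ^ lam 1 ≤ (2 * L⁻¹ * M) ^ lam 1 :=
      Real.rpow_le_rpow (by positivity) (by gcongr) hl
    have h0 : 0 ≤ (ℓ * M) ^ lam 1 := by positivity
    exact (mul_le_mul_of_nonneg_right (le_abs_self _) h0).trans
      (mul_le_mul_of_nonneg_left this (abs_nonneg _))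
  refine (measure_le_card_filter (μ δ) (T ℓ) (fun x => {F | ∃ C ∈ F, Traversed C 1 x ℓ M⁻¹})
    (c := u * L ^ (d - lam 1 + ε / 4) * M ^ (lam 1 * (1 + ε))) (by positivity) hprob).trans'
      (measure_mono fun F hF => ?_) |>.trans (ENNReal.ofReal_le_ofReal ?_)
  · simp only [mem_ofPred_eq, crossedCount] at hF ⊢
    convert hF
  · have hcard := card_net_le hT hB (hδ.2.trans hδ1) n (δ := δ)
    rw [div_le_iff₀ (by positivity)]
    refine (mul_le_mul_of_nonneg_right hcard (by positivity)).trans (le_of_eq ?_)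
    rw [← two_pow_rpow_neg, ← two_pow_rpow_neg, ← hL, ← hM, Real.mul_rpow (by positivity)
      (by positivity), Real.mul_rpow (by positivity) (by positivity), Real.inv_rpow hL0.le,
      ← Real.rpow_neg hL0.le]
    have e1 : L ^ (-(ε / 4)) * L ^ (d - lam 1 + ε / 4) = L ^ d * L ^ (-lam 1) := by
      rw [← Real.rpow_add hL0, ← Real.rpow_natCast, ← Real.rpow_add hL0]
      congr 1
      ring
    have e2 : M ^ (-(lam 1 * ε)) * M ^ (lam 1 * (1 + ε)) = M ^ lam 1 := by
      rw [← Real.rpow_add hM0]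
      congr 1
      ring
    calc _ = B * |K 1| * 2 ^ lam 1 * (L ^ d * L ^ (-lam 1)) * M ^ lam 1 := by ring
      _ = _ := by
        rw [← e1, ← e2]
        field_simp

theorem exists_measure_not_fewCrossed_le (hT : IsNetFamily Λ B T) (hB : 0 < B)
    (hδ1 : δmax ≤ 1) (hH1 : HypothesisH1 δmax μ K lam) (hl : 0 ≤ lam 1) {ε : ℝ} (hε : 0 < ε)
    {η : ℝ} (hη : 0 < η) :
    ∃ u > 0, ∀ δ ∈ Ioc 0 δmax,
      μ δ {F | ¬ FewCrossed T δ (d - lam 1 + ε / 4) (lam 1 * (1 + ε)) u F} ≤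
        ENNReal.ofReal η := by
  set q₁ : ℝ := 2 ^ (-(ε / 4)) with hq₁
  set q₂ : ℝ := 2 ^ (-(lam 1 * ε)) with hq₂
  set S : ℝ := (1 - q₁)⁻¹ * (1 - q₂)⁻¹ with hS
  set u : ℝ := max (B * 2 ^ lam 1) (B * |K 1| * 2 ^ lam 1 * S / η) with hu
  have hu0 : 0 < u := lt_max_of_lt_left (by positivity)
  have hq₁0 : 0 < q₁ := by positivity
  have hq₂0 : 0 < q₂ := by positivity
  have hq₁1 : q₁ < 1 := two_rpow_neg_lt_one (by positivity)
  refine ⟨u, hu0, fun δ hδ => ?_⟩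
  have htriv : ∀ (F : Config Λ) (n m : ℕ), δ ≤ 2 * ((2 : ℝ) ^ n)⁻¹ →
      (lam 1 = 0 ∨ ((2 : ℝ) ^ m)⁻¹ ≤ max δ ((2 : ℝ) ^ n)⁻¹) →
      (crossedCount (T (max δ ((2 : ℝ) ^ n)⁻¹)) F (max δ ((2 : ℝ) ^ n)⁻¹) ((2 : ℝ) ^ m)⁻¹ : ℝ) ≤
        u * ((2 : ℝ) ^ n) ^ (d - lam 1 + ε / 4) * ((2 : ℝ) ^ m) ^ (lam 1 * (1 + ε)) :=
    fun F n m h1 h2 => (crossedCount_le_of_trivial hT hB (hδ.2.trans hδ1) hl hε F h1 h2).trans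
      (by gcongr; exact le_max_left _ _)
  rcases hl.eq_or_lt with h0 | h0
  -- For `lam 1 = 0` the series over `m` has ratio 1 and diverges, but then the trivial bound holds
  -- at all scales.
  · have : {F : Config Λ | ¬ FewCrossed T δ (d - lam 1 + ε / 4) (lam 1 * (1 + ε)) u F} = ∅ :=
      eq_empty_of_forall_notMem fun F hF => hF fun n m h1 => htriv F n m h1 (Or.inl h0.symm)
    simp [this]
  have hq₂1 : q₂ < 1 := two_rpow_neg_lt_one (by positivity)
  set c : ℝ := B * |K 1| * 2 ^ lam 1 / u with hc
  have hc0 : 0 ≤ c := by positivity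
  have hsub : {F : Config Λ | ¬ FewCrossed T δ (d - lam 1 + ε / 4) (lam 1 * (1 + ε)) u F} ⊆
      ⋃ p : ℕ × ℕ, {F | (δ ≤ 2 * ((2 : ℝ) ^ p.1)⁻¹ ∧
        max δ ((2 : ℝ) ^ p.1)⁻¹ < ((2 : ℝ) ^ p.2)⁻¹) ∧
        u * ((2 : ℝ) ^ p.1) ^ (d - lam 1 + ε / 4) * ((2 : ℝ) ^ p.2) ^ (lam 1 * (1 + ε)) ≤
        (crossedCount (T (max δ ((2 : ℝ) ^ p.1)⁻¹)) F (max δ ((2 : ℝ) ^ p.1)⁻¹)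
          ((2 : ℝ) ^ p.2)⁻¹ : ℝ)} := by
    intro F hF
    simp only [FewCrossed, not_forall, mem_ofPred_eq] at hF
    obtain ⟨n, m, h1, h2⟩ := hF
    refine mem_iUnion.2 ⟨(n, m), ⟨h1, ?_⟩, (not_le.1 h2).le⟩
    by_contra h3
    exact h2 (htriv F n m h1 (Or.inr (not_lt.1 h3)))
  have hterm : ∀ p : ℕ × ℕ, μ δ {F | (δ ≤ 2 * ((2 : ℝ) ^ p.1)⁻¹ ∧
        max δ ((2 : ℝ) ^ p.1)⁻¹ < ((2 : ℝ) ^ p.2)⁻¹) ∧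
        u * ((2 : ℝ) ^ p.1) ^ (d - lam 1 + ε / 4) * ((2 : ℝ) ^ p.2) ^ (lam 1 * (1 + ε)) ≤
        (crossedCount (T (max δ ((2 : ℝ) ^ p.1)⁻¹)) F (max δ ((2 : ℝ) ^ p.1)⁻¹)
          ((2 : ℝ) ^ p.2)⁻¹ : ℝ)} ≤ ENNReal.ofReal (c * (q₁ ^ p.1 * q₂ ^ p.2)) := by
    intro p
    by_cases h : δ ≤ 2 * ((2 : ℝ) ^ p.1)⁻¹ ∧ max δ ((2 : ℝ) ^ p.1)⁻¹ < ((2 : ℝ) ^ p.2)⁻¹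
    · exact (measure_mono fun F hF => hF.2).trans
        (measure_crossedCount_ge_le hT hB hδ1 hH1 hδ hl ε hu0 h.1 h.2)
    · simp only [h, false_and]
      simp
  have hs₁ := hasSum_geometric_of_lt_one hq₁0.le hq₁1
  have hs₂ := hasSum_geometric_of_lt_one hq₂0.le hq₂1
  have hsum : HasSum (fun p : ℕ × ℕ => c * (q₁ ^ p.1 * q₂ ^ p.2)) (c * S) :=
    (hs₁.mul hs₂ (hs₁.summable.mul_of_nonneg hs₂.summable (fun n => by positivity)
      (fun n => by positivity))).mul_left c
  calc _ ≤ _ := measure_mono hsub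
    _ ≤ _ := measure_iUnion_le _
    _ ≤ ∑' p : ℕ × ℕ, ENNReal.ofReal (c * (q₁ ^ p.1 * q₂ ^ p.2)) := ENNReal.tsum_le_tsum hterm
    _ = ENNReal.ofReal (c * S) := by
      rw [← ENNReal.ofReal_tsum_of_nonneg (fun p => by positivity) hsum.summable, hsum.tsum_eq]
    _ ≤ _ := by
      refine ENNReal.ofReal_le_ofReal ?_
      have : B * |K 1| * 2 ^ lam 1 * S / η ≤ u := le_max_right _ _
      rw [div_le_iff₀ hη] at this
      rw [hc, div_mul_eq_mul_div, div_le_iff₀ hu0]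
      linarith

/-- The ratio of the radii is `ℓ ^ β`, so each net point contributes at most a multiple of `ℓ ^ (d +
1)`, against about `ℓ⁻ᵈ` points; a factor `ℓ = 2⁻ⁿ` is left over. -/
theorem measure_multipleCrossing_le (hT : IsNetFamily Λ B T) (hB : 0 < B)
    (hH1 : HypothesisH1 δmax μ K lam) {δ : ℝ} (hδ : δ ∈ Ioc 0 δmax) {β : ℝ}
    (hβ0 : 0 < β) (hβ1 : β ≤ 1) {k : ℕ} (hk : 1 ≤ k) (hkβ : d + 1 ≤ β * lam k) {n : ℕ} (hn : 1 ≤ n)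
    (hδn : δ ≤ ((2 : ℝ) ^ n)⁻¹) :
    μ δ (⋃ x ∈ T ((2 : ℝ) ^ n)⁻¹,
      {F | ∃ C ∈ F, Traversed C k x ((2 : ℝ) ^ n)⁻¹ (((2 : ℝ) ^ n)⁻¹ ^ (1 - β))}) ≤
      ENNReal.ofReal (B * |K k| * (1 / 2) ^ n) := by
  set L := (2 : ℝ) ^ n with hL
  have hL0 : 0 < L := by positivity
  have hL1 : 1 < L := one_lt_pow₀ one_lt_two (by omega)
  have hLi1 : L⁻¹ < 1 := inv_lt_one_of_one_lt₀ hL1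
  have hLi0 : 0 < L⁻¹ := inv_pos.2 hL0
  have hprob : ∀ x, μ δ {F | ∃ C ∈ F, Traversed C k x L⁻¹ (L⁻¹ ^ (1 - β))} ≤
      ENNReal.ofReal (|K k| * L⁻¹ ^ (d + 1)) := by
    intro x
    refine (hH1.1 k hk δ hδ x _ _ hδn ?_ (Real.rpow_le_one hLi0.le hLi1.le (by linarith))).trans
      (ENNReal.ofReal_le_ofReal ?_)
    · conv_lhs => rw [← Real.rpow_one L⁻¹]
      exact Real.rpow_lt_rpow_of_exponent_gt hLi0 hLi1 (by linarith)
    · have e : L⁻¹ / L⁻¹ ^ (1 - β) = L⁻¹ ^ β := by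
        rw [div_eq_iff (by positivity), ← Real.rpow_add hLi0, add_sub_cancel,
          Real.rpow_one]
      rw [e, ← Real.rpow_mul hLi0.le, ← Real.rpow_natCast]
      push_cast
      have h1 : L⁻¹ ^ (β * lam k) ≤ L⁻¹ ^ ((d : ℝ) + 1) :=
        Real.rpow_le_rpow_of_exponent_ge hLi0 hLi1.le hkβ
      exact (mul_le_mul_of_nonneg_right (le_abs_self _) (by positivity)).trans
        (mul_le_mul_of_nonneg_left h1 (abs_nonneg _))
  calc _ ≤ ∑ x ∈ T L⁻¹, μ δ {F | ∃ C ∈ F, Traversed C k x L⁻¹ (L⁻¹ ^ (1 - β))} :=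
        measure_biUnion_finset_le _ _
    _ ≤ ∑ _x ∈ T L⁻¹, ENNReal.ofReal (|K k| * L⁻¹ ^ (d + 1)) :=
        Finset.sum_le_sum fun x _ => hprob x
    _ = ENNReal.ofReal ((T L⁻¹).card * (|K k| * L⁻¹ ^ (d + 1))) := by
        rw [Finset.sum_const, nsmul_eq_mul, ENNReal.ofReal_mul (p := ((T L⁻¹).card : ℝ))
          (by positivity), ENNReal.ofReal_natCast]
    _ ≤ _ := by
        refine ENNReal.ofReal_le_ofReal ?_
        have h1 := (hT L⁻¹ ⟨hLi0, hLi1.le⟩).1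
        rw [inv_inv] at h1
        refine (mul_le_mul_of_nonneg_right h1 (by positivity)).trans (le_of_eq ?_)
        have e : (1 / 2 : ℝ) ^ n = L⁻¹ := by rw [hL, one_div, inv_pow]
        rw [e, pow_succ, inv_pow]
        field_simp

theorem exists_measure_not_noMultipleCrossing_le (hT : IsNetFamily Λ B T) (hB : 0 < B)
    (hH1 : HypothesisH1 δmax μ K lam) {β : ℝ}
    (hβ0 : 0 < β) (hβ1 : β ≤ 1) {k : ℕ} (hk : 1 ≤ k) (hkβ : d + 1 ≤ β * lam k)
    {η : ℝ} (hη : 0 < η) :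
    ∃ n₀ : ℕ, ∀ δ ∈ Ioc 0 δmax,
      μ δ {F | ¬ NoMultipleCrossing T δ β k n₀ F} ≤ ENNReal.ofReal η := by
  set c := B * |K k| with hc
  have hc0 : 0 ≤ c := by positivity
  -- The tail from `n₁ + 1` on sums to `c * (1 / 2) ^ n₁`; the added 1 in the denominator allows `c
  -- = 0`.
  obtain ⟨n₁, hn₁⟩ := exists_pow_lt_of_lt_one (show 0 < η / (2 * c + 1) by positivity)
    (show (1 / 2 : ℝ) < 1 by norm_num)
  refine ⟨n₁ + 1, fun δ hδ => ?_⟩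
  set A : ℕ → Set (Config Λ) := fun n => {F | δ ≤ ((2 : ℝ) ^ n)⁻¹ ∧
    F ∈ ⋃ x ∈ T ((2 : ℝ) ^ n)⁻¹,
      {F | ∃ C ∈ F, Traversed C k x ((2 : ℝ) ^ n)⁻¹ (((2 : ℝ) ^ n)⁻¹ ^ (1 - β))}} with hA
  have hsub : {F : Config Λ | ¬ NoMultipleCrossing T δ β k (n₁ + 1) F} ⊆
      ⋃ j, A (j + (n₁ + 1)) := by
    intro F hF
    simp only [NoMultipleCrossing, not_forall, mem_ofPred_eq, not_not] at hF
    obtain ⟨n, hn, h1, x, hx, h2⟩ := hF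
    refine mem_iUnion.2 ⟨n - (n₁ + 1), ?_⟩
    rw [Nat.sub_add_cancel hn]
    exact ⟨h1, mem_iUnion₂.2 ⟨x, hx, h2⟩⟩
  have hterm : ∀ j, μ δ (A (j + (n₁ + 1))) ≤
      ENNReal.ofReal (c * (1 / 2) ^ (n₁ + 1) * (1 / 2) ^ j) := by
    intro j
    by_cases h : δ ≤ ((2 : ℝ) ^ (j + (n₁ + 1)))⁻¹
    · refine (measure_mono fun F hF => hF.2).trans ((measure_multipleCrossing_le hT hB hH1
        hδ hβ0 hβ1 hk hkβ (by omega) h).trans (le_of_eq ?_))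
      rw [pow_add]
      congr 1
      ring
    · simp [hA, h]
  have hsum := (hasSum_geometric_two).mul_left (c * (1 / 2) ^ (n₁ + 1))
  calc _ ≤ _ := measure_mono hsub
    _ ≤ _ := measure_iUnion_le _
    _ ≤ ∑' j : ℕ, ENNReal.ofReal (c * (1 / 2) ^ (n₁ + 1) * (1 / 2) ^ j) :=
      ENNReal.tsum_le_tsum hterm
    _ = ENNReal.ofReal (c * (1 / 2) ^ (n₁ + 1) * 2) := by
      rw [← ENNReal.ofReal_tsum_of_nonneg (fun p => by positivity) hsum.summable, hsum.tsum_eq]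
    _ ≤ _ := by
      refine ENNReal.ofReal_le_ofReal ?_
      rw [lt_div_iff₀ (by positivity)] at hn₁
      have h0 : 0 < (1 / 2 : ℝ) ^ n₁ := by positivity
      rw [pow_succ]
      nlinarith

end Bounds

/-! ### Deterministic estimates -/

section Counting

variable {d : ℕ} {Λ : Set (EuclideanSpace ℝ (Fin d))} {C : Curve Λ} {F : Config Λ}
  {γ : ParamCurve Λ} {n : ℕ} {v : ℕ → EuclideanSpace ℝ (Fin d)}

open Classical in
theorem exists_mem_crossed (hCF : C ∈ F) (hC : Parametrizes γ C)
    (hf : RunsThrough (fun t => (γ.toMap t : EuclideanSpace ℝ (Fin d))) n v) (hn : 1 ≤ n)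
    {ℓ R : ℝ} (hR0 : 0 < R) (hR : 4 * R ≤ Metric.diam (range γ.toMap))
    {T : Finset (EuclideanSpace ℝ (Fin d))} (hT : ∀ y ∈ Λ, ∃ x ∈ T, dist y x ≤ ℓ) {i : ℕ}
    (hi : i ≤ n) :
    ∃ x ∈ T.filter fun x => ∃ C ∈ F, Traversed C 1 x ℓ R, dist (v i) x ≤ ℓ := by
  have h1 := hf.apply_vertexTime hn hi
  obtain ⟨x, hx, hd⟩ := hT _ (γ.toMap (vertexTime n i)).2
  refine ⟨x, Finset.mem_filter.2 ⟨hx, C, hCF, traversed_one_of_dist_le hC hR0 hR hd⟩, ?_⟩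
  rw [← h1]
  exact hd

/-- The balls about the crossed net points alone already cover all vertices, and each of them starts
at most `k` pieces. -/
theorem card_cuts_le_crossedCount (hCF : C ∈ F) (hC : Parametrizes γ C)
    (hf : RunsThrough (fun t => (γ.toMap t : EuclideanSpace ℝ (Fin d))) n v) (hn : 1 ≤ n)
    {ℓ R : ℝ} (hR0 : 0 < R) (hR : 4 * R ≤ Metric.diam (range γ.toMap))
    {T : Finset (EuclideanSpace ℝ (Fin d))} (hT : ∀ y ∈ Λ, ∃ x ∈ T, dist y x ≤ ℓ) {k : ℕ}
    {r R' : ℝ} (hr : R' + ℓ ≤ r) (hk : ∀ x ∈ T, ¬ ∃ C ∈ F, Traversed C k x ℓ R') :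
    (cuts v r n).card ≤ k * crossedCount T F ℓ R := by
  classical
  refine card_cuts_le (ℓ := ℓ) _ (fun i hi => exists_mem_crossed hCF hC hf hn hR0 hR hT hi)
    fun x hx P hP hPx => ?_
  by_contra! hlt
  exact hk x (Finset.mem_filter.1 hx).1 ⟨C, hCF, traversed_of_subset_cuts hC hf hn hP hlt.le hPx hr⟩

/-- The same covering at scale `δ`, with the local complexity bound `N` in place of the exclusion of
multiple crossings. -/
theorem steps_le_crossedCount (hCF : C ∈ F) (hC : Parametrizes γ C)
    (hf : RunsThrough (fun t => (γ.toMap t : EuclideanSpace ℝ (Fin d))) n v) (hn : 1 ≤ n)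
    {δ R : ℝ} (hR0 : 0 < R) (hR : 4 * R ≤ Metric.diam (range γ.toMap))
    {T : Finset (EuclideanSpace ℝ (Fin d))} (hT : ∀ y ∈ Λ, ∃ x ∈ T, dist y x ≤ δ) {N : ℕ}
    (hN : ∀ x, {i : ℕ | i ≤ n ∧ dist (v i) x ≤ δ}.ncard ≤ N) :
    n ≤ N * crossedCount T F δ R := by
  classical
  have h1 : ∀ i ∈ Finset.range (n + 1),
      ∃ x ∈ T.filter fun x => ∃ C ∈ F, Traversed C 1 x δ R, dist (v i) x ≤ δ := fun i hi =>
    exists_mem_crossed hCF hC hf hn hR0 hR hT (Nat.lt_succ_iff.1 (Finset.mem_range.1 hi))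
  choose! f hf1 hf2 using h1
  have h2 : (Finset.range (n + 1)).card ≤
      N * (T.filter fun x => ∃ C ∈ F, Traversed C 1 x δ R).card := by
    refine Finset.card_le_mul_card_image_of_maps_to (f := f) hf1 N fun x _ => ?_
    refine le_trans ?_ (hN x)
    rw [← Set.ncard_coe_finset]
    refine Set.ncard_le_ncard (fun i hi => ?_) ((Set.finite_Iic n).subset fun i hi => hi.1)
    rw [Finset.mem_coe, Finset.mem_filter] at hi
    exact ⟨Nat.lt_succ_iff.1 (Finset.mem_range.1 hi.1), hi.2 ▸ hf2 i hi.1⟩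
  rw [Finset.card_range] at h2
  have h3 : (T.filter fun x => ∃ C ∈ F, Traversed C 1 x δ R).card = crossedCount T F δ R := by
    rw [crossedCount]
  rw [h3] at h2
  omega

end Counting

theorem exists_scale {δ : ℝ} (hδ0 : 0 < δ) (hδ1 : δ ≤ 1) :
    ∃ n : ℕ, (2 : ℝ) ^ n ≤ δ⁻¹ ∧ δ⁻¹ < 2 ^ (n + 1) :=
  exists_nat_pow_near ((one_le_inv₀ hδ0).2 hδ1) one_lt_two

/-- A distance `ρ` which is controlled at the dyadic levels above `δ` and, linearly, below them,
is controlled by the power law of exponent `s`. -/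
theorem rpow_le_of_levels {s β a δ D ρ Δ A₁ A₂ : ℝ} {n₀ : ℕ} (hs : 1 ≤ s) (hβ0 : 0 ≤ β)
    (hβ1 : β ≤ 1) (has : a ≤ (1 - β) * s) (hδ0 : 0 < δ) (hδ1 : δ ≤ 1)
    (hρ0 : 0 ≤ ρ) (hρD : ρ ≤ D) (hΔ : 0 ≤ Δ) (hA₁ : 0 ≤ A₁) (hA₂ : 0 ≤ A₂)
    (h₁ : ρ ≤ A₁ * (δ * (2 * δ⁻¹) ^ a) * Δ)
    (h₂ : ∀ j ≥ n₀, δ ≤ ((2 : ℝ) ^ j)⁻¹ → 6 * (((2 : ℝ) ^ j)⁻¹) ^ (1 - β) < ρ →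
      (((2 : ℝ) ^ j)⁻¹) ^ ((1 - β) * s) ≤ A₂ * Δ) :
    ρ ^ s ≤ ((12 + D * 2 ^ n₀) ^ (s - 1) * (A₁ * 2 ^ a) + (12 + D * 2 ^ n₀) ^ s * A₂) * Δ := by
  have hD0 : 0 ≤ D := hρ0.trans hρD
  -- 12 is twice the 6 of `h₂`, the loss in passing to a neighbouring dyadic level; `D * 2 ^ n₀`
  -- absorbs distances too large for the levels from `n₀` on.
  set c : ℝ := 12 + D * 2 ^ n₀ with hc
  have hc12 : 12 ≤ c := by
    have : 0 ≤ D * 2 ^ n₀ := by positivity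
    linarith
  have hcD : D * 2 ^ n₀ ≤ c := by linarith
  have hself : ∀ x : ℝ, 0 < x → x ≤ 1 → x ≤ x ^ (1 - β) := fun x h0 h1 => by
    conv_lhs => rw [← Real.rpow_one x]
    exact Real.rpow_le_rpow_of_exponent_ge h0 h1 (by linarith)
  have htwo : ∀ x : ℝ, 0 < x → (2 * x) ^ (1 - β) ≤ 2 * x ^ (1 - β) := fun x h0 => by
    rw [Real.mul_rpow zero_le_two h0.le]
    gcongr
    conv_rhs => rw [← Real.rpow_one (2 : ℝ)]
    exact Real.rpow_le_rpow_of_exponent_le one_le_two (by linarith)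
  rw [add_mul]
  rcases le_or_gt ρ (c * δ ^ (1 - β)) with h | h
  · refine le_add_of_le_of_nonneg ?_ (by positivity)
    rcases hρ0.eq_or_lt with h0 | h0
    · rw [← h0, Real.zero_rpow (by linarith)]
      positivity
    -- Near or below the cutoff, one factor `ρ` is estimated linearly and the others by `c * δ ^ (1
    -- - β)`; this needs `s ≥ 1`.
    have e1 : ρ ^ s = ρ ^ (s - 1) * ρ := by
      conv_rhs => rw [← Real.rpow_one ρ, ← Real.rpow_mul h0.le, ← Real.rpow_add h0]
      congr 1
      ring
    have e2 : (δ ^ (1 - β)) ^ (s - 1) * (δ * (2 * δ⁻¹) ^ a) =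
        2 ^ a * δ ^ ((1 - β) * s + β - a) := by
      rw [← Real.rpow_mul hδ0.le, Real.mul_rpow zero_le_two (by positivity), Real.inv_rpow hδ0.le,
        ← Real.rpow_neg hδ0.le]
      have : δ ^ ((1 - β) * s + β - a) = δ ^ ((1 - β) * (s - 1)) * δ * δ ^ (-a) := by
        conv_rhs => rw [← Real.rpow_add_one hδ0.ne', ← Real.rpow_add hδ0]
        congr 1
        ring
      rw [this]
      ring
    have e3 : δ ^ ((1 - β) * s + β - a) ≤ 1 := Real.rpow_le_one hδ0.le hδ1 (by linarith)
    calc ρ ^ s = ρ ^ (s - 1) * ρ := e1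
      _ ≤ (c * δ ^ (1 - β)) ^ (s - 1) * (A₁ * (δ * (2 * δ⁻¹) ^ a) * Δ) := by
        have := Real.rpow_le_rpow h0.le h (show 0 ≤ s - 1 by linarith)
        gcongr
      _ = c ^ (s - 1) * (A₁ * 2 ^ a) * Δ * δ ^ ((1 - β) * s + β - a) := by
        rw [Real.mul_rpow (by positivity) (by positivity)]
        linear_combination (c ^ (s - 1) * A₁ * Δ) * e2
      _ ≤ _ := mul_le_of_le_one_right (by positivity) e3
  · refine le_add_of_nonneg_of_le (by positivity) ?_
    obtain ⟨n, hn1, hn2⟩ := exists_scale hδ0 hδ1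
    have hδn : δ ≤ ((2 : ℝ) ^ n)⁻¹ := by
      rwa [le_inv_comm₀ hδ0 (by positivity)]
    have hnδ : ((2 : ℝ) ^ n)⁻¹ ≤ 2 * δ := by
      rw [inv_lt_comm₀ hδ0 (by positivity), pow_succ, mul_inv] at hn2
      linarith
    have hn0 : n₀ ≤ n := by
      by_contra! hlt
      have h3 : (2 : ℝ) ^ (n + 1) ≤ 2 ^ n₀ := pow_le_pow_right₀ one_le_two hlt
      have h4 : 1 ≤ 2 ^ n₀ * δ := by
        have := hn2.le.trans h3
        rwa [inv_le_iff_one_le_mul₀ hδ0] at this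
      have h5 : D ≤ D * (2 ^ n₀ * δ ^ (1 - β)) :=
        le_mul_of_one_le_right hD0 (h4.trans (by gcongr; exact hself δ hδ0 hδ1))
      have h6 : D * 2 ^ n₀ * δ ^ (1 - β) ≤ c * δ ^ (1 - β) := by gcongr
      linarith
    have hnρ : 6 * (((2 : ℝ) ^ n)⁻¹) ^ (1 - β) < ρ := by
      have h3 : (((2 : ℝ) ^ n)⁻¹) ^ (1 - β) ≤ (2 * δ) ^ (1 - β) :=
        Real.rpow_le_rpow (by positivity) hnδ (by linarith)
      have h4 := htwo δ hδ0
      have h5 : 12 * δ ^ (1 - β) ≤ c * δ ^ (1 - β) := by gcongr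
      linarith
    have hex : ∃ j, n₀ ≤ j ∧ 6 * (((2 : ℝ) ^ j)⁻¹) ^ (1 - β) < ρ := ⟨n, hn0, hnρ⟩
    classical
    -- The coarsest level that still resolves `ρ`: failure of the previous level, or `ρ ≤ D` if `j =
    -- n₀`, bounds `ρ` from above.
    obtain ⟨j, hj, hjmin⟩ : ∃ j, (n₀ ≤ j ∧ 6 * (((2 : ℝ) ^ j)⁻¹) ^ (1 - β) < ρ) ∧
        ∀ i < j, ¬ (n₀ ≤ i ∧ 6 * (((2 : ℝ) ^ i)⁻¹) ^ (1 - β) < ρ) :=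
      ⟨Nat.find hex, Nat.find_spec hex, fun i hi => Nat.find_min hex hi⟩
    have hjn : j ≤ n := by
      by_contra! hlt
      exact hjmin n hlt ⟨hn0, hnρ⟩
    have hδj : δ ≤ ((2 : ℝ) ^ j)⁻¹ := hδn.trans (by gcongr; exact one_le_two)
    have hx0 : 0 < ((2 : ℝ) ^ j)⁻¹ := by positivity
    have hx1 : ((2 : ℝ) ^ j)⁻¹ ≤ 1 := inv_le_one_of_one_le₀ (one_le_pow₀ one_le_two)
    have hρj : ρ ≤ c * (((2 : ℝ) ^ j)⁻¹) ^ (1 - β) := by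
      rcases hj.1.eq_or_lt with h0 | h0
      · have h3 : (1 : ℝ) ≤ 2 ^ n₀ * (((2 : ℝ) ^ j)⁻¹) ^ (1 - β) := by
          calc (1 : ℝ) = 2 ^ n₀ * ((2 : ℝ) ^ j)⁻¹ := by
                rw [h0, mul_inv_cancel₀ (by positivity)]
            _ ≤ _ := by gcongr; exact hself _ hx0 hx1
        have h5 : D ≤ D * (2 ^ n₀ * (((2 : ℝ) ^ j)⁻¹) ^ (1 - β)) := le_mul_of_one_le_right hD0 h3
        have h6 : D * 2 ^ n₀ * (((2 : ℝ) ^ j)⁻¹) ^ (1 - β) ≤ c * (((2 : ℝ) ^ j)⁻¹) ^ (1 - β) := by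
          gcongr
        linarith
      · obtain ⟨i, rfl⟩ : ∃ i, j = i + 1 := ⟨j - 1, by omega⟩
        have h3 : ρ ≤ 6 * (((2 : ℝ) ^ i)⁻¹) ^ (1 - β) := by
          by_contra! hlt
          exact hjmin i (by omega) ⟨by omega, hlt⟩
        have h4 : ((2 : ℝ) ^ i)⁻¹ = 2 * ((2 : ℝ) ^ (i + 1))⁻¹ := by
          rw [pow_succ]
          field_simp
        have h5 := htwo _ hx0
        rw [h4] at h3
        have h6 : 12 * (((2 : ℝ) ^ (i + 1))⁻¹) ^ (1 - β) ≤
            c * (((2 : ℝ) ^ (i + 1))⁻¹) ^ (1 - β) := by gcongr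
        linarith
    calc ρ ^ s ≤ (c * (((2 : ℝ) ^ j)⁻¹) ^ (1 - β)) ^ s :=
          Real.rpow_le_rpow hρ0 hρj (by linarith)
      _ = c ^ s * (((2 : ℝ) ^ j)⁻¹) ^ ((1 - β) * s) := by
          rw [Real.mul_rpow (by positivity) (by positivity), ← Real.rpow_mul hx0.le]
      _ ≤ c ^ s * (A₂ * Δ) := by
          gcongr
          exact h₂ j hj.1 hδj hj.2
      _ = _ := by ring

theorem parametrizes_reparam {X : Type*} [PseudoMetricSpace X] {γ : ParamCurve X} {C : Curve X}
    (h : Parametrizes γ C) (φ : I ≃ₜ I) : Parametrizes ⟨γ.reparam φ⟩ C := by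
  rw [Parametrizes] at h ⊢
  rw [← h, SeparationQuotient.mk_eq_mk, Metric.inseparable_iff]
  refine le_antisymm ?_ dist_nonneg
  refine (curveDist_le _ _ (Homeomorph.refl I) φ).trans
    (dist_self (γ.reparam φ)).le

/-! ### Parametrization of a single curve of a good configuration -/

section Deterministic

variable {d : ℕ} {Λ : Set (EuclideanSpace ℝ (Fin d))} {C : Curve Λ} {F : Config Λ}
  {γ : ParamCurve Λ} {n : ℕ} {v : ℕ → EuclideanSpace ℝ (Fin d)} {B : ℝ}
  {T : ℝ → Finset (EuclideanSpace ℝ (Fin d))} {s β a b δ u D : ℝ} {N k n₀ m : ℕ}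

theorem steps_le_of_fewCrossed (hT : IsNetFamily Λ B T) (hδ0 : 0 < δ) (hδ1 : δ ≤ 1) (ha : 0 ≤ a)
    (hu : 0 ≤ u) (hfew : FewCrossed T δ a b u F) (hCF : C ∈ F) (hC : Parametrizes γ C)
    (hf : RunsThrough (fun t => (γ.toMap t : EuclideanSpace ℝ (Fin d))) n v) (hn : 1 ≤ n)
    (hN : ∀ x, {i : ℕ | i ≤ n ∧ dist (v i) x ≤ δ}.ncard ≤ N)
    (hm : 4 * ((2 : ℝ) ^ m)⁻¹ ≤ Metric.diam (range γ.toMap)) :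
    (n : ℝ) ≤ N * (u * (2 * δ⁻¹) ^ a * ((2 : ℝ) ^ m) ^ b) := by
  -- Level `i + 1` is the one just below `δ`, where the maximum in `FewCrossed` equals `δ` itself.
  obtain ⟨i, hi1, hi2⟩ := exists_scale hδ0 hδ1
  have h1 : ((2 : ℝ) ^ (i + 1))⁻¹ ≤ δ := by
    rw [inv_le_comm₀ (by positivity) hδ0]
    exact hi2.le
  have h2 : δ ≤ 2 * ((2 : ℝ) ^ (i + 1))⁻¹ := by
    rw [le_inv_comm₀ (by positivity) hδ0] at hi1
    refine hi1.trans (le_of_eq ?_)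
    rw [pow_succ]
    field_simp
  have h3 := hfew (i + 1) m h2
  rw [max_eq_left h1] at h3
  have h4 : (n : ℝ) ≤ N * crossedCount (T δ) F δ ((2 : ℝ) ^ m)⁻¹ := by
    exact_mod_cast steps_le_crossedCount hCF hC hf hn (by positivity) hm (hT δ ⟨hδ0, hδ1⟩).2 hN
  have h5 : (2 : ℝ) ^ (i + 1) ≤ 2 * δ⁻¹ := by rw [pow_succ]; linarith
  have h6 := Real.rpow_le_rpow (by positivity) h5 ha
  refine h4.trans (mul_le_mul_of_nonneg_left (h3.trans ?_) (by positivity))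
  gcongr

theorem card_cuts_le_of_fewCrossed (hT : IsNetFamily Λ B T) (hβ0 : 0 ≤ β)
    (hfew : FewCrossed T δ a b u F) (hno : NoMultipleCrossing T δ β k n₀ F) (hCF : C ∈ F)
    (hC : Parametrizes γ C)
    (hf : RunsThrough (fun t => (γ.toMap t : EuclideanSpace ℝ (Fin d))) n v) (hn : 1 ≤ n)
    (hm : 4 * ((2 : ℝ) ^ m)⁻¹ ≤ Metric.diam (range γ.toMap)) {j : ℕ} (hj : n₀ ≤ j)
    (hδj : δ ≤ ((2 : ℝ) ^ j)⁻¹) :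
    ((cuts v (2 * ((2 : ℝ) ^ j)⁻¹ ^ (1 - β)) n).card : ℝ) ≤
      k * (u * ((2 : ℝ) ^ j) ^ a * ((2 : ℝ) ^ m) ^ b) := by
  have hx0 : 0 < ((2 : ℝ) ^ j)⁻¹ := by positivity
  have hx1 : ((2 : ℝ) ^ j)⁻¹ ≤ 1 := inv_le_one_of_one_le₀ (one_le_pow₀ one_le_two)
  have hx2 : ((2 : ℝ) ^ j)⁻¹ ≤ ((2 : ℝ) ^ j)⁻¹ ^ (1 - β) := by
    conv_lhs => rw [← Real.rpow_one ((2 : ℝ) ^ j)⁻¹]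
    exact Real.rpow_le_rpow_of_exponent_ge hx0 hx1 (by linarith)
  have h3 := hfew j m (hδj.trans (by linarith))
  rw [max_eq_right hδj] at h3
  have h4 : ((cuts v (2 * ((2 : ℝ) ^ j)⁻¹ ^ (1 - β)) n).card : ℝ) ≤
      k * crossedCount (T ((2 : ℝ) ^ j)⁻¹) F ((2 : ℝ) ^ j)⁻¹ ((2 : ℝ) ^ m)⁻¹ := by
    have h5 := card_cuts_le_crossedCount (r := 2 * ((2 : ℝ) ^ j)⁻¹ ^ (1 - β)) hCF hC hf hn
      (by positivity) hm (hT _ ⟨hx0, hx1⟩).2 (by linarith) (hno j hj hδj)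
    exact_mod_cast h5
  exact h4.trans (mul_le_mul_of_nonneg_left h3 (by positivity))

/-- The constant in the Hölder estimate, up to its dependence on the diameter of the curve. -/
noncomputable def holderConst (s β a u D : ℝ) (N k n₀ : ℕ) : ℝ :=
  (12 + D * 2 ^ n₀) ^ (s - 1) * (2 * N * u * 2 ^ a) +
    (12 + D * 2 ^ n₀) ^ s * (k * u * (2 / (1 - 2 ^ (-((1 - β) * s - a)))))

/-- The clock charges each cut at level `j` a time proportional to `ℓ ^ ((1 - β) * s)`, `ℓ = 2⁻ʲ`.
There are at most of order `ℓ ^ (-a)` such cuts, so `a < (1 - β) * s` makes the total charge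
converge. -/
theorem exists_parametrization_rpow_le (hT : IsNetFamily Λ B T) (hs : 1 ≤ s) (hβ0 : 0 ≤ β)
    (hβ1 : β ≤ 1) (ha : 0 ≤ a) (has : a < (1 - β) * s) (hδ0 : 0 < δ) (hδ1 : δ ≤ 1)
    (hu : 0 < u) (hk : 1 ≤ k) (hD : ∀ x y : Λ, dist x y ≤ D)
    (hfew : FewCrossed T δ a b u F) (hno : NoMultipleCrossing T δ β k n₀ F) (hCF : C ∈ F)
    (hC : Parametrizes γ C)
    (hf : RunsThrough (fun t => (γ.toMap t : EuclideanSpace ℝ (Fin d))) n v) (hn : 1 ≤ n)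
    (hv : ∀ i < n, dist (v i) (v (i + 1)) ≤ δ)
    (hN : ∀ x, {i : ℕ | i ≤ n ∧ dist (v i) x ≤ δ}.ncard ≤ N)
    (hm : 4 * ((2 : ℝ) ^ m)⁻¹ ≤ Metric.diam (range γ.toMap)) :
    ∃ γ' : ParamCurve Λ, Parametrizes γ' C ∧ range γ'.toMap = range γ.toMap ∧
      ∀ t₁ t₂ : I, t₁ < t₂ → dist (γ'.toMap t₁) (γ'.toMap t₂) ^ s ≤
        holderConst s β a u D N k n₀ * ((2 : ℝ) ^ m) ^ b * ((t₂ : ℝ) - t₁) := by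
  classical
  set Q : ℝ := ((2 : ℝ) ^ m) ^ b with hQ
  have hQ0 : 0 < Q := by positivity
  set q : ℝ := 2 ^ (-((1 - β) * s - a)) with hq
  have hq0 : 0 < q := by positivity
  have hq1 : q < 1 := two_rpow_neg_lt_one (by linarith)
  have hk0 : (0 : ℝ) < k := by exact_mod_cast hk
  -- Chosen so that level `j` uses at most `(1 - q) / 2 * q ^ j` of the time, and all levels
  -- together at most 1/2.
  set A₂ : ℝ := k * u * (2 / (1 - q)) * Q with hA₂
  have hA₂0 : 0 < A₂ := by
    have : 0 < 1 - q := by linarith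
    positivity
  set r : ℕ → ℝ := fun j => 2 * ((2 : ℝ) ^ j)⁻¹ ^ (1 - β) with hr
  set p : ℕ → ℝ := fun j => (((2 : ℝ) ^ j)⁻¹) ^ ((1 - β) * s) / A₂ with hp
  obtain ⟨M, -, hM⟩ := exists_scale hδ0 hδ1
  set J : Finset ℕ := (Finset.range (M + 1)).filter fun j => n₀ ≤ j ∧ δ ≤ ((2 : ℝ) ^ j)⁻¹ with hJ
  have hsum : ∑ j ∈ J, p j * (cuts v (r j) n).card ≤ 1 / 2 := by
    have hterm : ∀ j ∈ J, p j * (cuts v (r j) n).card ≤ (1 - q) / 2 * q ^ j := by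
      intro j hj
      obtain ⟨-, hj1, hj2⟩ := Finset.mem_filter.1 hj
      refine (mul_le_mul_of_nonneg_left (card_cuts_le_of_fewCrossed hT hβ0 hfew hno hCF hC hf hn hm
        hj1 hj2) (by positivity)).trans (le_of_eq ?_)
      have hx : 0 < (2 : ℝ) ^ j := by positivity
      have e : q ^ j = (((2 : ℝ) ^ j)⁻¹) ^ ((1 - β) * s) * ((2 : ℝ) ^ j) ^ a := by
        rw [hq, ← two_pow_rpow_neg, Real.inv_rpow hx.le, ← Real.rpow_neg hx.le, ← Real.rpow_add hx]
        congr 1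
        ring
      rw [e, hp, hA₂]
      have : 1 - q ≠ 0 := by linarith
      field_simp
      exact hQ.symm
    refine (Finset.sum_le_sum hterm).trans ?_
    rw [← Finset.mul_sum]
    have hgeo := hasSum_geometric_of_lt_one hq0.le hq1
    have := sum_le_hasSum J (fun j _ => by positivity) hgeo
    have h1 : 0 < 1 - q := by linarith
    calc _ ≤ (1 - q) / 2 * (1 - q)⁻¹ := by gcongr
      _ = 1 / 2 := by field_simp
  obtain ⟨ψ, hψ1, hψ2, hψ3⟩ := hf.exists_homeomorph hn hv J r p (fun j => by positivity)
    (fun j => by positivity) hsum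
  refine ⟨⟨γ.reparam ψ.symm⟩, parametrizes_reparam hC _, ?_, fun t₁ t₂ ht => ?_⟩
  · exact ψ.symm.surjective.range_comp γ.toMap
  change dist (γ.toMap (ψ.symm t₁)) (γ.toMap (ψ.symm t₂)) ^ s ≤ _
  obtain ⟨τ₁, rfl⟩ := ψ.surjective t₁
  obtain ⟨τ₂, rfl⟩ := ψ.surjective t₂
  rw [ψ.symm_apply_apply, ψ.symm_apply_apply]
  have hτ : τ₁ ≤ τ₂ := (hψ1.lt_iff_lt.1 ht).le
  have hΔ : (0 : ℝ) ≤ (ψ τ₂ : ℝ) - ψ τ₁ := sub_nonneg.2 ht.le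
  refine (rpow_le_of_levels (A₁ := 2 * N * u * Q) (A₂ := A₂) (n₀ := n₀) hs hβ0 hβ1 has.le hδ0 hδ1
    dist_nonneg (hD _ _) hΔ (by positivity) hA₂0.le ?_ fun j hj hδj hlt => ?_).trans
    (le_of_eq ?_)
  · have h1 : dist (γ.toMap τ₁) (γ.toMap τ₂) ≤ n * δ * ((τ₂ : ℝ) - τ₁) := hf.dist_le hn hv hτ
    have h2 := hψ2 τ₁ τ₂ hτ
    have h3 := steps_le_of_fewCrossed hT hδ0 hδ1 ha hu.le hfew hCF hC hf hn hN hm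
    calc _ ≤ n * δ * ((τ₂ : ℝ) - τ₁) := h1
      _ ≤ n * δ * (2 * ((ψ τ₂ : ℝ) - ψ τ₁)) := by gcongr; linarith
      _ ≤ N * (u * (2 * δ⁻¹) ^ a * Q) * δ * (2 * ((ψ τ₂ : ℝ) - ψ τ₁)) := by gcongr
      _ = _ := by ring
  · have hjJ : j ∈ J := by
      refine Finset.mem_filter.2 ⟨Finset.mem_range.2 ?_, hj, hδj⟩
      rw [le_inv_comm₀ hδ0 (by positivity)] at hδj
      exact (pow_lt_pow_iff_right₀ (one_lt_two (α := ℝ))).1 (hδj.trans_lt hM)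
    have hx0 : 0 < ((2 : ℝ) ^ j)⁻¹ := by positivity
    have hx1 : ((2 : ℝ) ^ j)⁻¹ ≤ 1 := inv_le_one_of_one_le₀ (one_le_pow₀ one_le_two)
    have hx2 : ((2 : ℝ) ^ j)⁻¹ ≤ ((2 : ℝ) ^ j)⁻¹ ^ (1 - β) := by
      conv_lhs => rw [← Real.rpow_one ((2 : ℝ) ^ j)⁻¹]
      exact Real.rpow_le_rpow_of_exponent_ge hx0 hx1 (by linarith)
    have h1 : p j ≤ (ψ τ₂ : ℝ) - ψ τ₁ := by
      -- The 6 arises here: `2 * r j + 2 * δ ≤ 4 * ℓ ^ (1 - β) + 2 * ℓ`, with `ℓ = 2⁻ʲ` at most `ℓ ^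
      -- (1 - β)`.
      refine hψ3 τ₁ τ₂ hτ j hjJ (lt_of_le_of_lt ?_ hlt)
      simp only [hr]
      linarith
    rw [hp, div_le_iff₀ hA₂0] at h1
    linarith
  · rw [holderConst, hA₂]
    ring

/-- From the power bound to the form of the Hölder estimate in which the dependence on the diameter
is explicit. -/
theorem le_of_rpow_le {s l e b U D D' ρ Δ : ℝ} {m : ℕ} (hs : 0 < s) (hl : 0 ≤ l)
    (he : 0 < e) (hes : e ≤ s) (hb : 0 ≤ b) (hU : 0 ≤ U) (hD : 0 < D) (hD' : 0 ≤ D')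
    (hm : (2 : ℝ) ^ m ≤ D' / D) (hρ : 0 ≤ ρ) (hΔ : 0 ≤ Δ)
    (h : ρ ^ s ≤ U * ((2 : ℝ) ^ m) ^ (l * b) * Δ) :
    ρ ≤ U ^ (1 / s) * D' ^ (l * b / e) * (D ^ (-(l / e))) ^ b * Δ ^ (1 / s) := by
  have h1 : ρ ≤ (U * ((2 : ℝ) ^ m) ^ (l * b) * Δ) ^ (1 / s) := by
    rw [one_div, Real.le_rpow_inv_iff_of_pos hρ (by positivity) hs]
    exact h
  have h2 : (((2 : ℝ) ^ m) ^ (l * b)) ^ (1 / s) ≤ D' ^ (l * b / e) * (D ^ (-(l / e))) ^ b := by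
    have h3 : l * b * (1 / s) ≤ l * b / e := by
      rw [mul_one_div]
      gcongr
    calc _ = ((2 : ℝ) ^ m) ^ (l * b * (1 / s)) := by rw [← Real.rpow_mul (by positivity)]
      _ ≤ ((2 : ℝ) ^ m) ^ (l * b / e) :=
        Real.rpow_le_rpow_of_exponent_le (one_le_pow₀ one_le_two) h3
      _ ≤ (D' / D) ^ (l * b / e) := Real.rpow_le_rpow (by positivity) hm (by positivity)
      _ = _ := by
        rw [Real.div_rpow hD' hD.le, div_eq_mul_inv, ← Real.rpow_neg hD.le,
          ← Real.rpow_mul hD.le]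
        congr 2
        ring
  refine h1.trans ?_
  rw [Real.mul_rpow (by positivity) hΔ, Real.mul_rpow hU (by positivity)]
  rw [mul_assoc (U ^ (1 / s)) (D' ^ _)]
  exact mul_le_mul_of_nonneg_right (mul_le_mul_of_nonneg_left h2 (by positivity)) (by positivity)

/-- What matters is the order of quantifiers: `κ` is fixed before `δ`, the configuration and the
curve. Only the outer radius `2⁻ᵐ` is adapted to the curve. -/
theorem exists_holder_parametrization (hT : IsNetFamily Λ B T) {l ε : ℝ} (hl : 0 ≤ l)
    (hld : l < d) (hε : 0 < ε) (hs : 1 ≤ d - l + ε) (hβ0 : 0 ≤ β) (hβ1 : β ≤ 1)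
    (has : d - l + ε / 4 < (1 - β) * (d - l + ε)) (hu : 0 < u) (hk : 1 ≤ k)
    (hD : ∀ x y : Λ, dist x y ≤ D) :
    ∃ κ : ℝ, ∀ δ ∈ Ioc (0 : ℝ) 1, ∀ F : Config Λ,
      FewCrossed T δ (d - l + ε / 4) (l * (1 + ε)) u F → NoMultipleCrossing T δ β k n₀ F →
      ∀ C ∈ F, IsPolygonal δ N C → ∃ γ : ParamCurve Λ, Parametrizes γ C ∧
        ∀ t₁ t₂ : I, t₁ < t₂ → dist (γ.toMap t₁) (γ.toMap t₂) ≤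
          κ * (Metric.diam (range γ.toMap) ^ (-(l / (d - l)))) ^ (1 + ε)
            * ((t₂ : ℝ) - t₁) ^ (1 / (d - l + ε)) := by
  set U := holderConst (d - l + ε) β (d - l + ε / 4) u (max 4 D) N k n₀ with hU
  have hD4 : (0 : ℝ) < max 4 D := lt_max_of_lt_left (by norm_num)
  have hU0 : 0 ≤ U := by
    have hq1 : (2 : ℝ) ^ (-((1 - β) * (d - l + ε) - (d - l + ε / 4))) < 1 :=
      two_rpow_neg_lt_one (by linarith)
    have : 0 ≤ 2 / (1 - (2 : ℝ) ^ (-((1 - β) * (d - l + ε) - (d - l + ε / 4)))) :=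
      div_nonneg zero_le_two (by linarith)
    rw [hU, holderConst]
    positivity
  set κ := U ^ (1 / (d - l + ε)) * (2 * max 4 D) ^ (l * (1 + ε) / (d - l)) with hκ
  have hκ0 : 0 ≤ κ := by positivity
  refine ⟨κ, fun δ hδ F hfew hno C hCF hpoly => ?_⟩
  obtain ⟨γ, n, v, hC, hn, hv, hf, hN⟩ := hpoly
  have hbdd : Bornology.IsBounded (range γ.toMap) := (isCompact_range γ.toMap.continuous).isBounded
  rcases (Metric.diam_nonneg (s := range γ.toMap)).eq_or_lt with h0 | h0
  · refine ⟨γ, hC, fun t₁ t₂ ht => ?_⟩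
    have h1 := Metric.dist_le_diam_of_mem hbdd (mem_range_self t₁) (mem_range_self t₂)
    rw [← h0] at h1 ⊢
    refine h1.trans ?_
    have : (0 : ℝ) ≤ (t₂ : ℝ) - t₁ := sub_nonneg.2 ht.le
    positivity
  · have hdiam : Metric.diam (range γ.toMap) ≤ D :=
      Metric.diam_le_of_forall_dist_le (dist_nonneg.trans (hD (γ.toMap 0) (γ.toMap 0)))
        fun x _ y _ => hD x y
    set Dg := Metric.diam (range γ.toMap) with hDg
    -- `2 ^ (i + 1)` is comparable to `1 / Dg`; the maximum with 1 handles curves of diameter above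
    -- 4, at a cost bounded through `D`.
    obtain ⟨i, hi1, hi2⟩ := exists_nat_pow_near (le_max_left 1 (4 / Dg)) (one_lt_two (α := ℝ))
    have hm : 4 * ((2 : ℝ) ^ (i + 1))⁻¹ ≤ Dg := by
      have := (le_max_right 1 (4 / Dg)).trans hi2.le
      rw [div_le_iff₀ h0] at this
      rw [← div_eq_mul_inv, div_le_iff₀ (by positivity)]
      linarith
    have hm2 : (2 : ℝ) ^ (i + 1) ≤ 2 * max 4 D / Dg := by
      have h1 : max 1 (4 / Dg) ≤ max 4 D / Dg := by
        refine max_le ?_ (by gcongr; exact le_max_left _ _)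
        rw [le_div_iff₀ h0, one_mul]
        exact hdiam.trans (le_max_right _ _)
      rw [pow_succ, mul_div_assoc]
      linarith
    obtain ⟨γ', hC', hr, hγ'⟩ := exists_parametrization_rpow_le hT hs hβ0 hβ1 (by linarith) has
      hδ.1 hδ.2 hu hk (fun x y => (hD x y).trans (le_max_right 4 D)) hfew hno hCF hC hf hn hv hN hm
    refine ⟨γ', hC', fun t₁ t₂ ht => ?_⟩
    rw [hr]
    exact le_of_rpow_le (by linarith) hl (by linarith) (by linarith) (by linarith) hU0 h0
      (by positivity) hm2 dist_nonneg (sub_nonneg.2 ht.le) (hγ' t₁ t₂ ht)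

end Deterministic

/-- Regularity of random curves: Hölder continuous parametrizations, simultaneously for all curves
of the configuration, with a common stochastically bounded prefactor. -/
theorem mainTheorem1 (d : ℕ) (Λ : Set (EuclideanSpace ℝ (Fin d))) (hΛ : IsCompact Λ)
    (δmax : ℝ) (hδ0 : 0 < δmax) (hδ1 : δmax ≤ 1)
    (μ : ℝ → Measure (Config Λ)) (hμ : IsSystem δmax μ)
    (K lam : ℕ → ℝ) (hH1 : HypothesisH1 δmax μ K lam)
    (hlam0 : 0 ≤ lam 1) (hlamd : lam 1 < d)
    (ε : ℝ) (hε : 0 < ε) (hεd : 1 ≤ d - lam 1 + ε) :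
    ∃ κ : ℝ → Config Λ → ℝ,
      (∀ δ ∈ Ioc 0 δmax, Measurable (κ δ)) ∧
      StochasticallyBounded δmax μ κ ∧
      ∀ δ ∈ Ioc 0 δmax, ∀ᵐ F ∂(μ δ), ∀ C ∈ F,
        ∃ γ : ParamCurve Λ, Parametrizes γ C ∧
          ∀ t₁ t₂ : I, t₁ < t₂ →
            dist (γ.toMap t₁) (γ.toMap t₂) ≤
              κ δ F * (Metric.diam (range γ.toMap) ^ (-(lam 1 / (d - lam 1)))) ^ (1 + ε)
                * ((t₂ : ℝ) - t₁) ^ (1 / (d - lam 1 + ε)) := by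
  obtain ⟨N, hN⟩ := hμ.2
  obtain ⟨B, T, hB, hT⟩ := exists_isNetFamily hΛ.isBounded
  obtain ⟨D, hD⟩ := Metric.isBounded_iff.1 hΛ.isBounded
  set s : ℝ := d - lam 1 + ε with hs
  -- Then `(1 - β) * s = d - lam 1 + ε / 2`, which leaves a gap `ε / 4` above the counting exponent
  -- `d - lam 1 + ε / 4`.
  set β : ℝ := ε / 2 / s with hβ
  have hs0 : 0 < s := by linarith
  have hβ0 : 0 < β := by positivity
  have hβs : β * s = ε / 2 := div_mul_cancel₀ _ hs0.ne'
  have hβ1 : β ≤ 1 := by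
    rw [hβ, div_le_one hs0]
    linarith
  obtain ⟨k, hkβ, hk⟩ : ∃ k : ℕ, (d + 1) / β ≤ lam k ∧ 1 ≤ k :=
    ((hH1.2.eventually_ge_atTop ((d + 1) / β)).and (eventually_ge_atTop 1)).exists
  rw [div_le_iff₀' hβ0] at hkβ
  -- Being polygonal is a premise inside the event, so that the inclusion below holds for every
  -- configuration; it is discharged almost surely at the end.
  set Bad : ℝ → ℕ → Set (Config Λ) := fun δ u => {F | ¬ ((∀ C ∈ F, IsPolygonal δ N C) →
    ∀ C ∈ F, ∃ γ : ParamCurve Λ, Parametrizes γ C ∧ ∀ t₁ t₂ : I, t₁ < t₂ →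
      dist (γ.toMap t₁) (γ.toMap t₂) ≤
        u * (Metric.diam (range γ.toMap) ^ (-(lam 1 / (d - lam 1)))) ^ (1 + ε)
          * ((t₂ : ℝ) - t₁) ^ (1 / s))} with hBad
  obtain ⟨κ, hκ1, hκ2, hκ3⟩ := exists_stochasticallyBounded (δmax := δmax) (μ := μ) Bad (by
    intro η hη
    obtain ⟨u, hu, hfew⟩ := exists_measure_not_fewCrossed_le hT hB hδ1 hH1 hlam0 hε (half_pos hη)
    obtain ⟨n₀, hno⟩ := exists_measure_not_noMultipleCrossing_le hT hB hH1 hβ0 hβ1 hk hkβ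
      (half_pos hη)
    obtain ⟨κ, hκ⟩ := exists_holder_parametrization (β := β) (n₀ := n₀) (N := N) hT hlam0 hlamd hε
      hεd hβ0.le hβ1 (by rw [sub_mul, ← hs, hβs]; linarith) hu hk
      (fun x y => hD x.2 y.2)
    refine ⟨⌈κ⌉₊, fun δ hδ => ?_⟩
    have hsub : Bad δ ⌈κ⌉₊ ⊆ {F | ¬ FewCrossed T δ (d - lam 1 + ε / 4) (lam 1 * (1 + ε)) u F} ∪
        {F | ¬ NoMultipleCrossing T δ β k n₀ F} := by
      intro F hF
      by_contra hcon
      rw [mem_union, not_or] at hcon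
      refine hF fun hpoly C hCF => ?_
      obtain ⟨γ, hγ, h⟩ := hκ δ ⟨hδ.1, hδ.2.trans hδ1⟩ F (not_not.1 hcon.1) (not_not.1 hcon.2) C hCF
        (hpoly C hCF)
      refine ⟨γ, hγ, fun t₁ t₂ ht => (h t₁ t₂ ht).trans ?_⟩
      have h0 : (0 : ℝ) ≤ (t₂ : ℝ) - t₁ := sub_nonneg.2 ht.le
      have h1 := Metric.diam_nonneg (s := range γ.toMap)
      gcongr
      exact Nat.le_ceil κ
    calc _ ≤ _ := measure_mono hsub
      _ ≤ _ := measure_union_le _ _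
      _ ≤ ENNReal.ofReal (η / 2) + ENNReal.ofReal (η / 2) := add_le_add (hfew δ hδ) (hno δ hδ)
      _ = ENNReal.ofReal η := by
        rw [← ENNReal.ofReal_add (half_pos hη).le (half_pos hη).le, add_halves])
  refine ⟨κ, fun δ _ => hκ1 δ, hκ2, fun δ hδ => ?_⟩
  filter_upwards [hκ3 δ hδ, hN δ hδ] with F hF hpoly
  obtain ⟨u, hu, hgood⟩ := hF
  rw [hu]
  exact not_not.1 hgood hpoly
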